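/- **Setting (bandits with concave rewards).** There are $m$ arms and $T$ rounds. In each round $t$ an arm $i_t$ is chosen (possibly at random) from the history of the previous rounds, and a vector $v_t\in[0,1]^d$ is observed which, given the past and $i_t=i$, has a fixed unknown law $D_i$ with mean $V_i$; let $V\in[0,1]^{d\times m}$ be the matrix with columns $V_i$, and $\Delta_m$ the simplex of distributions over arms. Let $f:[0,1]^d\to[0,1]$ be concave, $L$-Lipschitz on $[0,1]^d$ with respect to an $L_q$ norm $\|\cdot\|$ ($1\le q\le\infty$), differentiable, and $\mathcal C$-smooth: $f(z+\alpha(y-z))\ge f(z)+\alpha\nabla f(z)\cdot(y-z)-\frac{\mathcal C}{2}\alpha^2$ for all $y,z\in[0,1]^d$ and $\alpha\in[0,1]$. Let $\mathrm{OPT}_f$ be the supremum, over all (randomized, history-dependent) policies, of $\mathbb E\big[f(\frac1T\sum_{t=1}^T v_t)\big]$; the average regret is $\mathrm{avg\text{-}regret}_1(T)=\mathrm{OPT}_f-f(\frac1T\sum_{t=1}^T v_t)$. **Algorithm.** Fix $\gamma>0$. Before round $t$, let $k_{t,i}$ be the number of earlier plays of arm $i$, let $\hat V_{t,ji}=\frac{1}{k_{t,i}+1}\sum_{s<t:\,i_s=i}v_{s,j}$,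 let $\mathrm{rad}(\nu,N)=\sqrt{\gamma\nu/N}+\gamma/N$, and let $H_t$ be the set of all $d\times m$ matrices $W$ with $$\max\{0,\hat V_{t,ji}-2\,\mathrm{rad}(\hat V_{t,ji},k_{t,i}+1)\}\le W_{ji}\le\min\{1,\hat V_{t,ji}+2\,\mathrm{rad}(\hat V_{t,ji},k_{t,i}+1)\}\quad\text{for all } i,j.$$ In round $t$ the algorithm takes $(p_t,\tilde V_t)\in\arg\max_{p\in\Delta_m,\,W\in H_t}(Wp)\cdot\nabla f(\bar x_{t-1})$ (any measurable, history-dependent choice among the maximizers), sets $x_t=\tilde V_tp_t$, and plays arm $i$ with probability $p_{t,i}$. Here $\bar x_t=\frac1t\sum_{s=1}^t x_s$ for $t\ge1$, and $\bar x_0$ is an arbitrary point of $[0,1]^d$. **Theorem.** There are absolute constants $c_0,K>0$ such that for all $m,d,T\ge1$ with $mdT\ge2$, all such $D$, $\|\cdot\|$ and $f$, all $\delta\in(0,1)$ and all $\gamma\ge c_0\log\frac{mTd}{\delta}$, the following two bounds hold together with probability at least $1-\delta$: $$\mathrm{avg\text{-}regret}_1(T)\le K\Big(L\,\|\mathbf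 1_d\|\sqrt{\tfrac{\gamma m}{T}}+\tfrac{\mathcal C\log T}{T}\Big),$$ $$f(Vp)-f(\bar x_T)\le\frac{\mathcal C\log_2(2T)}{2T}\qquad\text{for every }p\in\Delta_m .$$ -/

import Mathlib

open MeasureTheory
open scoped Matrix unitInterval ENNReal

noncomputable section

namespace BwR

/-! ### Vectors, norms and smoothness -/

/-- The unit cube `[0,1]^d`. -/
def cube (d : ℕ) : Set (Fin d → ℝ) := Set.Icc 0 1

/-- The `L_q` norm of a vector of `ℝ^d`, for `1 ≤ q ≤ ∞`. -/
def lqNorm {d : ℕ} (q : ℝ≥0∞) (x : Fin d → ℝ) : ℝ :=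
  ‖(WithLp.toLp q x : PiLp q (fun _ : Fin d => ℝ))‖

/-- `f` is `L`-Lipschitz on the unit cube with respect to the `L_q` norm. -/
def IsLipschitz {d : ℕ} (q : ℝ≥0∞) (L : ℝ) (f : (Fin d → ℝ) → ℝ) : Prop :=
  ∀ x ∈ cube d, ∀ y ∈ cube d, f x - f y ≤ L * lqNorm q (x - y)

/-- The gradient at `z` of a function on the unit cube (one-sided where `z` is on the boundary). -/
def grad {d : ℕ} (f : (Fin d → ℝ) → ℝ) (z : Fin d → ℝ) : Fin d → ℝ :=
  fun j => fderivWithin ℝ f (cube d) z (Pi.single j 1)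

/-- `f` is differentiable on the unit cube and `C`-smooth there. -/
def IsSmooth {d : ℕ} (C : ℝ) (f : (Fin d → ℝ) → ℝ) : Prop :=
  DifferentiableOn ℝ f (cube d) ∧
    ∀ y ∈ cube d, ∀ z ∈ cube d, ∀ α ∈ Set.Icc (0 : ℝ) 1,
      f z + α * (grad f z ⬝ᵥ (y - z)) - C / 2 * α ^ 2 ≤ f (z + α • (y - z))

/-! ### The bandit model -/

/-- A history of `t` rounds: for each round, the arm that was played and the vector in `[0,1]^d`
that was observed. -/
abbrev Hist (m d t : ℕ) : Type := Fin t → Fin m × (Fin d → I)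

/-- A (randomized, history-dependent) policy: after a history `h` of `t` rounds, arm `i` is played
with probability `prob t h i`. -/
structure Policy (m d : ℕ) where
  prob : (t : ℕ) → Hist m d t → Fin m → ℝ
  prob_mem : ∀ t h, prob t h ∈ stdSimplex ℝ (Fin m)
  prob_measurable : ∀ t, Measurable (prob t)

/-- The law of the history of the first `t` rounds when policy `π` is used and playing arm `i`
yields an observation with law `D i`, independent of the past. -/
def histLaw {m d : ℕ} (D : Fin m → Measure (Fin d → I)) (π : Policy m d) :
    (t : ℕ) → Measure (Hist m d t)
  | 0 => Measure.dirac Fin.elim0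
  | t + 1 => (histLaw D π t).bind fun h =>
      ∑ i, ENNReal.ofReal (π.prob t h i) •
        (D i).map fun c => (Fin.snoc (α := fun _ => Fin m × (Fin d → I)) h (i, c) :
          Hist m d (t + 1))

/-- The matrix of mean observations: column `i` is the mean of the law of arm `i`. -/
def meanMatrix {m d : ℕ} (D : Fin m → Measure (Fin d → I)) : Matrix (Fin d) (Fin m) ℝ :=
  fun j i => ∫ c, (c j : ℝ) ∂(D i)

/-- The average of the observed vectors. -/
def avgObs {m d t : ℕ} (h : Hist m d t) : Fin d → ℝ :=
  fun j => (∑ s, ((h s).2 j : ℝ)) / t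

/-- The expected value of the optimal dynamic solution: the supremum, over all policies, of the
expected value of `f` at the average of the `T` observed vectors. -/
def opt {m d : ℕ} (D : Fin m → Measure (Fin d → I)) (f : (Fin d → ℝ) → ℝ) (T : ℕ) : ℝ :=
  ⨆ π : Policy m d, ∫ h, f (avgObs h) ∂(histLaw D π T)

/-- The average regret in the objective. -/
def avgRegret {m d T : ℕ} (D : Fin m → Measure (Fin d → I)) (f : (Fin d → ℝ) → ℝ)
    (h : Hist m d T) : ℝ :=
  opt D f T - f (avgObs h)

/-! ### Confidence bounds -/

/-- The confidence radius. -/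
def rad (γ ν N : ℝ) : ℝ := √(γ * ν / N) + γ / N

/-- The number of plays of arm `i` in a history. -/
def plays {m d t : ℕ} (h : Hist m d t) (i : Fin m) : ℕ :=
  (Finset.univ.filter fun s => (h s).1 = i).card

/-- The empirical average of component `j` of the observations of arm `i`. -/
def emp {m d t : ℕ} (h : Hist m d t) (j : Fin d) (i : Fin m) : ℝ :=
  (∑ s ∈ Finset.univ.filter fun s => (h s).1 = i, ((h s).2 j : ℝ)) / (plays h i + 1)

/-- Upper confidence bound. -/
def ucb {m d t : ℕ} (γ : ℝ) (h : Hist m d t) (j : Fin d) (i : Fin m) : ℝ :=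
  min 1 (emp h j i + 2 * rad γ (emp h j i) (plays h i + 1))

/-- Lower confidence bound. -/
def lcb {m d t : ℕ} (γ : ℝ) (h : Hist m d t) (j : Fin d) (i : Fin m) : ℝ :=
  max 0 (emp h j i - 2 * rad γ (emp h j i) (plays h i + 1))

/-- The set of all matrices that lie entrywise between the confidence bounds. -/
def confSet {m d t : ℕ} (γ : ℝ) (h : Hist m d t) : Set (Matrix (Fin d) (Fin m) ℝ) :=
  {W | ∀ j i, W j i ∈ Set.Icc (lcb γ h j i) (ucb γ h j i)}

/-! ### The primal algorithm -/

/-- A policy which, together with the distribution over arms, also chooses after each history an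
estimate of the matrix of means. -/
structure EstPolicy (m d : ℕ) extends Policy m d where
  est : (t : ℕ) → Hist m d t → Matrix (Fin d) (Fin m) ℝ
  est_measurable : ∀ t j i, Measurable fun h => est t h j i

/-- The running average `(1/t) ∑_{s=1}^t x_s` of the estimated mean observations `x_s`, each being
the chosen estimate applied to the chosen distribution in round `s`. The arbitrary initial point
`x₀` stands for the empty average. -/
def EstPolicy.avgEst {m d : ℕ} (A : EstPolicy m d) (x₀ : Fin d → ℝ) {t : ℕ} (h : Hist m d t) :
    Fin d → ℝ :=
  if t = 0 then x₀ else
    (t : ℝ)⁻¹ • ∑ s : Fin t,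
      A.est s (Fin.take s s.is_lt.le h) *ᵥ A.prob s (Fin.take s s.is_lt.le h)

/-- `A` is a run rule of the Frank-Wolfe based primal algorithm over `T` rounds: in each round the
pair (distribution `p`, estimate `W`) maximizes `(W p) ⬝ ∇f(running average)` over the simplex and
the confidence set. Ties may be broken in any way. -/
def EstPolicy.IsPrimal {m d : ℕ} (A : EstPolicy m d) (f : (Fin d → ℝ) → ℝ) (γ : ℝ)
    (x₀ : Fin d → ℝ) (T : ℕ) : Prop :=
  ∀ t < T, ∀ h : Hist m d t, A.est t h ∈ confSet γ h ∧
    ∀ p ∈ stdSimplex ℝ (Fin m), ∀ W ∈ confSet γ h,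
      (W *ᵥ p) ⬝ᵥ grad f (A.avgEst x₀ h) ≤ (A.est t h *ᵥ A.prob t h) ⬝ᵥ grad f (A.avgEst x₀ h)

end BwR

end

noncomputable section

namespace BwR

/-! ### Histories -/

/-! The argument is optimism combined with Frank-Wolfe. Suppose the true mean matrix V lies in every
confidence set. Then for each p the pair (p, V) competes in the maximization of every round, so the
chosen point x_t is at least as good as Vp in the direction of the gradient at the running average.
That average moves towards x_t with step 1/t, which is a Frank-Wolfe step. Concavity and smoothness
show that t times the gap to f(Vp) grows by at most C/(2t) in round t (`frankWolfe_step`). Summing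
gives a harmonic sum, hence the second bound (`EstPolicy.IsPrimal.sub_le`).

For the regret, Jensen's inequality bounds the optimum by the maximum of f(Vp), because the expected
average observation of any policy has the form Vp (`opt_le`). It remains to compare the average of
the x_t with the average observation (`abs_avgEst_sub_avgObs_le`). Each x_t differs from Vp_t by at
most the expected confidence width of the arm drawn. Up to a martingale, the expected widths sum to
the realized ones, which total O(√(γmT)) by counting plays and Cauchy-Schwarz (`pathSum_width_le`).
The difference between Vp_t and the observation is another martingale. The Lipschitz condition
finishes the estimate.

All tail bounds come from exponential supermartingales along the history
(`lintegral_exp_pathSum_le_one`). A union bound over rounds, play counts, arms, components and signs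
puts them into one event (`measure_compl_goodEvent_le`); the rest is deterministic on that event. -/

/-- The history extended by one round. -/
def extend {m d t : ℕ} (h : Hist m d t) (x : Fin m × (Fin d → I)) : Hist m d (t + 1) :=
  Fin.snoc (α := fun _ => Fin m × (Fin d → I)) h x

/-- The first `s` rounds of a history. -/
def pre {m d t : ℕ} (s : ℕ) (hs : s ≤ t) (h : Hist m d t) : Hist m d s :=
  fun i => h (Fin.castLE hs i)

section Hist

variable {m d t : ℕ}

@[simp]
theorem extend_castSucc (h : Hist m d t) (x : Fin m × (Fin d → I)) (s : Fin t) :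
    extend h x s.castSucc = h s := by
  simp [extend]

@[simp]
theorem extend_last (h : Hist m d t) (x : Fin m × (Fin d → I)) :
    extend h x (Fin.last t) = x := by
  simp [extend]

theorem pre_extend (h : Hist m d t) (x : Fin m × (Fin d → I)) {s : ℕ} (hs : s ≤ t)
    (hs' : s ≤ t + 1) : pre s hs' (extend h x) = pre s hs h := by
  funext i
  exact extend_castSucc h x (Fin.castLE hs i)

theorem measurable_pre {s : ℕ} (hs : s ≤ t) : Measurable (pre (m := m) (d := d) s hs) :=
  measurable_pi_iff.2 fun _ => measurable_pi_apply _

theorem measurable_extend :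
    Measurable fun y : Hist m d t × (Fin m × (Fin d → I)) => extend y.1 y.2 := by
  refine measurable_pi_iff.2 fun s => ?_
  refine Fin.lastCases ?_ (fun s => ?_) s
  · simpa using measurable_snd
  · simp only [extend_castSucc]
    exact (measurable_pi_apply s).comp measurable_fst

theorem measurable_extend_right (h : Hist m d t) (i : Fin m) :
    Measurable fun c : Fin d → I => extend h (i, c) :=
  measurable_extend.comp (measurable_const.prodMk (measurable_const.prodMk measurable_id))

theorem measurable_extend_arm (i : Fin m) :
    Measurable fun y : Hist m d t × (Fin d → I) => extend y.1 (i, y.2) :=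
  measurable_extend.comp (measurable_fst.prodMk (measurable_const.prodMk measurable_snd))

end Hist

/-! ### The law of the history -/

section Law

variable {m d : ℕ} (D : Fin m → Measure (Fin d → I)) (π : Policy m d)

/-- The conditional law of the next history. -/
def stepLaw (t : ℕ) (h : Hist m d t) : Measure (Hist m d (t + 1)) :=
  ∑ i, ENNReal.ofReal (π.prob t h i) • (D i).map fun c => extend h (i, c)

theorem histLaw_succ (t : ℕ) : histLaw D π (t + 1) = (histLaw D π t).bind (stepLaw D π t) := rfl

theorem measurable_prob (t : ℕ) (i : Fin m) : Measurable fun h => π.prob t h i :=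
  measurable_pi_iff.1 (π.prob_measurable t) i

theorem sum_ofReal_prob (t : ℕ) (h : Hist m d t) : ∑ i, ENNReal.ofReal (π.prob t h i) = 1 := by
  rw [← ENNReal.ofReal_sum_of_nonneg fun i _ => (π.prob_mem t h).1 i, (π.prob_mem t h).2,
    ENNReal.ofReal_one]

theorem lintegral_stepLaw (t : ℕ) (h : Hist m d t) {F : Hist m d (t + 1) → ℝ≥0∞}
    (hF : Measurable F) :
    ∫⁻ h', F h' ∂(stepLaw D π t h) =
      ∑ i, ENNReal.ofReal (π.prob t h i) * ∫⁻ c, F (extend h (i, c)) ∂(D i) := by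
  rw [stepLaw, lintegral_finsetSum_measure]
  refine Finset.sum_congr rfl fun i _ => ?_
  rw [lintegral_smul_measure, lintegral_map hF (measurable_extend_right h i), smul_eq_mul]

variable [∀ i, IsProbabilityMeasure (D i)]

theorem measurable_stepLaw (t : ℕ) : Measurable (stepLaw D π t) := by
  refine Measure.measurable_of_measurable_coe _ fun s hs => ?_
  have : (fun h => stepLaw D π t h s) = fun h => ∑ i, ENNReal.ofReal (π.prob t h i) *
      D i (Prod.mk h ⁻¹' ((fun y : Hist m d t × (Fin d → I) => extend y.1 (i, y.2)) ⁻¹' s)) := by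
    funext h
    simp only [stepLaw, Measure.coe_finsetSum, Finset.sum_apply, Measure.smul_apply, smul_eq_mul]
    refine Finset.sum_congr rfl fun i _ => ?_
    rw [Measure.map_apply (measurable_extend_right h i) hs]
    rfl
  rw [this]
  refine Finset.measurable_sum _ fun i _ => ?_
  exact (measurable_prob π t i).ennreal_ofReal.mul
    (measurable_measure_prodMk_left (measurable_extend_arm i hs))

theorem lintegral_histLaw_succ (t : ℕ) {F : Hist m d (t + 1) → ℝ≥0∞} (hF : Measurable F) :
    ∫⁻ h, F h ∂(histLaw D π (t + 1)) =
      ∫⁻ h, ∑ i, ENNReal.ofReal (π.prob t h i) * ∫⁻ c, F (extend h (i, c)) ∂(D i)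
        ∂(histLaw D π t) := by
  rw [histLaw_succ, Measure.lintegral_bind (measurable_stepLaw D π t).aemeasurable
    hF.aemeasurable]
  exact lintegral_congr fun h => lintegral_stepLaw D π t h hF

instance isProbabilityMeasure_histLaw (t : ℕ) : IsProbabilityMeasure (histLaw D π t) := by
  induction t with
  | zero => rw [histLaw]; infer_instance
  | succ t ih =>
    constructor
    rw [← lintegral_one, lintegral_histLaw_succ D π t measurable_const]
    simp [sum_ofReal_prob]

/-- A further round leaves the prefix unchanged, and the step law has total mass 1. -/
theorem lintegral_pre {s t : ℕ} (hs : s ≤ t) {F : Hist m d s → ℝ≥0∞} (hF : Measurable F) :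
    ∫⁻ h, F (pre s hs h) ∂(histLaw D π t) = ∫⁻ h, F h ∂(histLaw D π s) := by
  induction t, hs using Nat.le_induction with
  | base => rfl
  | succ t hs ih =>
    rw [lintegral_histLaw_succ D π t (F := fun h => F (pre s _ h)) (hF.comp (measurable_pre _)),
      ← ih]
    refine lintegral_congr fun h => ?_
    simp_rw [pre_extend h _ hs, lintegral_const, measure_univ, mul_one, ← Finset.sum_mul,
      sum_ofReal_prob, one_mul]

theorem map_pre {s t : ℕ} (hs : s ≤ t) :
    (histLaw D π t).map (pre s hs) = histLaw D π s := by
  refine Measure.ext_of_lintegral _ fun F hF => ?_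
  rw [lintegral_map hF (measurable_pre hs), lintegral_pre D π hs hF]

/-- Transfers tail bounds at an earlier round to the horizon. The inequality, unlike equality, holds
with no measurability of `B`. -/
theorem measure_pre_le {s t : ℕ} (hs : s ≤ t) (B : Set (Hist m d s)) :
    histLaw D π t (pre s hs ⁻¹' B) ≤ histLaw D π s B := by
  conv_rhs => rw [← map_pre D π hs]
  exact Measure.le_map_apply (measurable_pre hs).aemeasurable B

end Law

/-! ### Additive functionals of the history -/

section PathSum

variable {m d : ℕ}

/-- The sum over the rounds of an increment depending on the past and the current round. -/
def pathSum (Y : ∀ t, Hist m d t → Fin m × (Fin d → I) → ℝ) {t : ℕ} (h : Hist m d t) : ℝ :=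
  ∑ s : Fin t, Y s (pre s s.is_lt.le h) (h s)

theorem pathSum_extend (Y : ∀ t, Hist m d t → Fin m × (Fin d → I) → ℝ) {t : ℕ} (h : Hist m d t)
    (x : Fin m × (Fin d → I)) : pathSum Y (extend h x) = pathSum Y h + Y t h x := by
  rw [pathSum, Fin.sum_univ_castSucc]
  congr 1
  · refine Finset.sum_congr rfl fun s _ => ?_
    rw [extend_castSucc]
    congr 1
    exact pre_extend h x s.is_lt.le _
  · rw [extend_last]
    congr 1
    exact pre_extend h x le_rfl _

theorem extend_induction {P : ∀ t, Hist m d t → Prop} (h0 : ∀ h, P 0 h)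
    (hs : ∀ t h x, P t h → P (t + 1) (extend h x)) (t : ℕ) (h : Hist m d t) : P t h := by
  induction t with
  | zero => exact h0 h
  | succ t ih =>
    have : extend (pre t t.le_succ h) (h (Fin.last t)) = h := by
      funext s
      refine Fin.lastCases ?_ (fun s => ?_) s
      · simp
      · rw [extend_castSucc]; rfl
    rw [← this]
    exact hs _ _ _ (ih _)

theorem measurable_pathSum {Y : ∀ t, Hist m d t → Fin m × (Fin d → I) → ℝ}
    (hY : ∀ t, Measurable fun y : Hist m d t × (Fin m × (Fin d → I)) => Y t y.1 y.2) (t : ℕ) :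
    Measurable fun h : Hist m d t => pathSum Y h :=
  Finset.measurable_sum _ fun s _ =>
    (hY s).comp ((measurable_pre s.is_lt.le).prodMk (measurable_pi_apply s))

variable (D : Fin m → Measure (Fin d → I)) [∀ i, IsProbabilityMeasure (D i)] (π : Policy m d)

/-- The hypothesis `hstep` says that the exponential of `pathSum Y` is a supermartingale: given the
past, each round multiplies it by a factor of mean at most 1. -/
theorem lintegral_exp_pathSum_le_one {Y : ∀ t, Hist m d t → Fin m × (Fin d → I) → ℝ}
    (hY : ∀ t, Measurable fun y : Hist m d t × (Fin m × (Fin d → I)) => Y t y.1 y.2)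
    (hstep : ∀ t h, ∑ i, ENNReal.ofReal (π.prob t h i) *
      ∫⁻ c, ENNReal.ofReal (Real.exp (Y t h (i, c))) ∂(D i) ≤ 1) (t : ℕ) :
    ∫⁻ h, ENNReal.ofReal (Real.exp (pathSum Y h)) ∂(histLaw D π t) ≤ 1 := by
  induction t with
  | zero => simp [pathSum]
  | succ t ih =>
    rw [lintegral_histLaw_succ D π t (measurable_pathSum hY _).exp.ennreal_ofReal]
    refine le_trans (lintegral_mono fun h => ?_) ih
    have : ∀ i, ∫⁻ c, ENNReal.ofReal (Real.exp (pathSum Y (extend h (i, c)))) ∂(D i) =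
        ENNReal.ofReal (Real.exp (pathSum Y h)) *
          ∫⁻ c, ENNReal.ofReal (Real.exp (Y t h (i, c))) ∂(D i) := by
      intro i
      rw [← lintegral_const_mul']
      · simp_rw [pathSum_extend, Real.exp_add, ENNReal.ofReal_mul (Real.exp_pos _).le]
      · exact ENNReal.ofReal_ne_top
    simp_rw [this, mul_left_comm, ← Finset.mul_sum]
    exact mul_le_of_le_one_right' (hstep t h)

/-- Chernoff's inequality for an exponential supermartingale. -/
theorem measure_le_pathSum_le {Y : ∀ t, Hist m d t → Fin m × (Fin d → I) → ℝ}
    (hY : ∀ t, Measurable fun y : Hist m d t × (Fin m × (Fin d → I)) => Y t y.1 y.2)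
    (hstep : ∀ t h, ∑ i, ENNReal.ofReal (π.prob t h i) *
      ∫⁻ c, ENNReal.ofReal (Real.exp (Y t h (i, c))) ∂(D i) ≤ 1) (t : ℕ) (η : ℝ) :
    histLaw D π t {h | η ≤ pathSum Y h} ≤ ENNReal.ofReal (Real.exp (-η)) := by
  have h1 := mul_meas_ge_le_lintegral (μ := histLaw D π t)
    (measurable_pathSum hY t).exp.ennreal_ofReal (ENNReal.ofReal (Real.exp η))
  have h2 := h1.trans (lintegral_exp_pathSum_le_one D π hY hstep t)
  have h3 : {h : Hist m d t | η ≤ pathSum Y h} ⊆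
      {h | ENNReal.ofReal (Real.exp η) ≤ ENNReal.ofReal (Real.exp (pathSum Y h))} := fun h hh =>
    ENNReal.ofReal_le_ofReal (Real.exp_le_exp.2 hh)
  calc histLaw D π t {h | η ≤ pathSum Y h}
      = ENNReal.ofReal (Real.exp (-η)) * (ENNReal.ofReal (Real.exp η) *
          histLaw D π t {h | η ≤ pathSum Y h}) := by
        rw [← mul_assoc, ← ENNReal.ofReal_mul (Real.exp_pos _).le, ← Real.exp_add]
        simp
    _ ≤ ENNReal.ofReal (Real.exp (-η)) * 1 := by
        gcongr
        exact le_trans (by gcongr) h2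
    _ = _ := mul_one _

end PathSum

/-! ### Concentration -/

theorem exp_le_one_add_add_sq {x : ℝ} (hx : |x| ≤ 1) : Real.exp x ≤ 1 + x + x ^ 2 := by
  have := (abs_le.1 (Real.abs_exp_sub_one_sub_id_le hx)).2
  linarith

theorem integrable_of_abs_le_one {Ω : Type*} [MeasurableSpace Ω] {μ : Measure Ω}
    [IsFiniteMeasure μ] {g : Ω → ℝ} (hg : Measurable g) (hb : ∀ c, |g c| ≤ 1) :
    Integrable g μ :=
  Integrable.of_bound hg.aestronglyMeasurable 1 (ae_of_all _ fun c => hb c)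

/-- Integrates the quadratic bound on the exponential. The second moment is kept, since for the
empirical means it must later be bounded by the mean and not by 1. -/
theorem lintegral_exp_mul_sub_le {Ω : Type*} [MeasurableSpace Ω] (μ : Measure Ω)
    [IsProbabilityMeasure μ] {g : Ω → ℝ} (hg : Measurable g) (hb : ∀ c, |g c| ≤ 1) {l : ℝ}
    (hl : |l| ≤ 1) (b : ℝ) :
    ∫⁻ c, ENNReal.ofReal (Real.exp (l * g c - b)) ∂μ ≤
      ENNReal.ofReal ((1 + l * ∫ c, g c ∂μ + l ^ 2 * ∫ c, g c ^ 2 ∂μ) * Real.exp (-b)) := by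
  have hi := integrable_of_abs_le_one (μ := μ) hg hb
  have hi2 : Integrable (fun c => g c ^ 2) μ :=
    integrable_of_abs_le_one (hg.pow_const 2) fun c => by
      rw [abs_pow]; exact pow_le_one₀ (abs_nonneg _) (hb c)
  have hi1 : Integrable (fun c => 1 + l * g c) μ := (integrable_const 1).add (hi.const_mul l)
  have hi3 : Integrable (fun c => 1 + l * g c + l ^ 2 * g c ^ 2) μ := hi1.add (hi2.const_mul _)
  have hpt : ∀ c, Real.exp (l * g c) ≤ 1 + l * g c + l ^ 2 * g c ^ 2 := fun c => by
    have : |l * g c| ≤ 1 := by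
      rw [abs_mul]; exact mul_le_one₀ hl (abs_nonneg _) (hb c)
    have := exp_le_one_add_add_sq this
    rwa [mul_pow] at this
  have heq : (1 + l * ∫ c, g c ∂μ + l ^ 2 * ∫ c, g c ^ 2 ∂μ) * Real.exp (-b) =
      ∫ c, (1 + l * g c + l ^ 2 * g c ^ 2) * Real.exp (-b) ∂μ := by
    rw [integral_mul_const, integral_add hi1 (hi2.const_mul _),
      integral_add (integrable_const 1) (hi.const_mul l), integral_const_mul,
      integral_const_mul]
    simp
  rw [heq, ofReal_integral_eq_lintegral_ofReal (hi3.mul_const _)]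
  · refine lintegral_mono fun c => ENNReal.ofReal_le_ofReal ?_
    rw [sub_eq_add_neg, Real.exp_add]
    exact mul_le_mul_of_nonneg_right (hpt c) (Real.exp_pos _).le
  · exact ae_of_all _ fun c =>
      mul_nonneg ((Real.exp_pos _).le.trans (hpt c)) (Real.exp_pos _).le

section

variable {m d : ℕ} (D : Fin m → Measure (Fin d → I)) [∀ i, IsProbabilityMeasure (D i)]
  (π : Policy m d)

theorem abs_pathSum_le {Y : ∀ t, Hist m d t → Fin m × (Fin d → I) → ℝ}
    (hb : ∀ t h x, |Y t h x| ≤ 1) {t : ℕ} (h : Hist m d t) : |pathSum Y h| ≤ t := by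
  refine (Finset.abs_sum_le_sum_abs _ _).trans ?_
  refine (Finset.sum_le_sum fun s _ => hb _ _ _).trans ?_
  simp

/-- An Azuma type inequality for supermartingales with bounded increments. -/
theorem measure_lt_pathSum_le_of_centered {Y : ∀ t, Hist m d t → Fin m × (Fin d → I) → ℝ}
    (hY : ∀ t, Measurable fun y : Hist m d t × (Fin m × (Fin d → I)) => Y t y.1 y.2)
    (hb : ∀ t h x, |Y t h x| ≤ 1)
    (hc : ∀ t h, ∑ i, π.prob t h i * ∫ c, Y t h (i, c) ∂(D i) ≤ 0) (T : ℕ) {η : ℝ} (hη : 0 < η) :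
    histLaw D π T {h | 2 * √(η * T) < pathSum Y h} ≤ ENNReal.ofReal (Real.exp (-η)) := by
  -- For T < η the threshold exceeds the trivial bound T on the sum, so the event is empty.
  -- Otherwise √(η/T) ≤ 1 is an admissible exponent.
  rcases lt_or_ge (T : ℝ) η with hT | hT
  · have : {h : Hist m d T | 2 * √(η * T) < pathSum Y h} = ∅ := by
      refine Set.eq_empty_of_forall_notMem fun h hh => ?_
      have h1 := (le_abs_self _).trans (abs_pathSum_le hb h)
      have h2 : (T : ℝ) ≤ √(η * T) :=
        Real.le_sqrt_of_sq_le (by nlinarith [Nat.cast_nonneg (α := ℝ) T])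
      have h3 : 2 * √(η * T) < pathSum Y h := hh
      linarith [Real.sqrt_nonneg (η * T)]
    rw [this, measure_empty]
    exact zero_le
  have hT0 : (0 : ℝ) < T := hη.trans_le hT
  -- This choice makes l · 2√(ηT) − T l² equal to η.
  set l : ℝ := √(η / T) with hl
  have hl0 : 0 ≤ l := Real.sqrt_nonneg _
  have hl2 : l ^ 2 = η / T := Real.sq_sqrt (by positivity)
  have hl1 : |l| ≤ 1 := by
    rw [abs_of_nonneg hl0, hl, Real.sqrt_le_one, div_le_one hT0]
    exact hT
  let Z : ∀ t, Hist m d t → Fin m × (Fin d → I) → ℝ := fun t h x => l * Y t h x - l ^ 2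
  have hZ : ∀ t, Measurable fun y : Hist m d t × (Fin m × (Fin d → I)) => Z t y.1 y.2 :=
    fun t => ((hY t).const_mul l).sub_const _
  have hYm : ∀ t h i, Measurable fun c => Y t h (i, c) := fun t h i =>
    (hY t).comp (measurable_const.prodMk (measurable_const.prodMk measurable_id))
  have hstep : ∀ t h, ∑ i, ENNReal.ofReal (π.prob t h i) *
      ∫⁻ c, ENNReal.ofReal (Real.exp (Z t h (i, c))) ∂(D i) ≤ 1 := by
    intro t h
    have hp := π.prob_mem t h
    have h1 : ∀ i, ∫ c, Y t h (i, c) ^ 2 ∂(D i) ≤ 1 := fun i => by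
      have := integral_mono_of_nonneg (μ := D i) (f := fun c => Y t h (i, c) ^ 2)
        (g := fun _ => 1) (ae_of_all _ fun c => sq_nonneg _) (integrable_const _)
        (ae_of_all _ fun c => by
          have := pow_le_one₀ (n := 2) (abs_nonneg _) (hb t h (i, c))
          rwa [sq_abs] at this)
      simpa using this
    have h2 : ∀ i, ENNReal.ofReal (π.prob t h i) *
        ∫⁻ c, ENNReal.ofReal (Real.exp (Z t h (i, c))) ∂(D i) ≤ ENNReal.ofReal (π.prob t h i *
          ((1 + l * ∫ c, Y t h (i, c) ∂(D i) + l ^ 2) * Real.exp (-l ^ 2))) := fun i => by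
      rw [ENNReal.ofReal_mul (hp.1 i)]
      gcongr
      refine (lintegral_exp_mul_sub_le (D i) (hYm t h i) (fun c => hb _ _ _) hl1 _).trans ?_
      refine ENNReal.ofReal_le_ofReal (mul_le_mul_of_nonneg_right ?_ (Real.exp_pos _).le)
      nlinarith [h1 i, sq_nonneg l]
    have h0 : ∀ i, 0 ≤ 1 + l * ∫ c, Y t h (i, c) ∂(D i) + l ^ 2 := fun i => by
      have : |∫ c, Y t h (i, c) ∂(D i)| ≤ 1 := by
        have := norm_integral_le_of_norm_le_const (μ := D i) (f := fun c => Y t h (i, c))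
          (ae_of_all _ fun c => hb t h (i, c))
        simpa using this
      have : |l * ∫ c, Y t h (i, c) ∂(D i)| ≤ 1 := by
        rw [abs_mul]; exact mul_le_one₀ hl1 (abs_nonneg _) this
      nlinarith [(abs_le.1 this).1, sq_nonneg l]
    refine (Finset.sum_le_sum fun i _ => h2 i).trans ?_
    rw [← ENNReal.ofReal_sum_of_nonneg fun i _ =>
      mul_nonneg (hp.1 i) (mul_nonneg (h0 i) (Real.exp_pos _).le)]
    rw [ENNReal.ofReal_le_one]
    have h3 : ∑ i, π.prob t h i *
        ((1 + l * ∫ c, Y t h (i, c) ∂(D i) + l ^ 2) * Real.exp (-l ^ 2)) =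
        ((1 + l ^ 2) * ∑ i, π.prob t h i + l * ∑ i, π.prob t h i * ∫ c, Y t h (i, c) ∂(D i)) *
          Real.exp (-l ^ 2) := by
      rw [Finset.mul_sum, Finset.mul_sum, ← Finset.sum_add_distrib, Finset.sum_mul]
      exact Finset.sum_congr rfl fun i _ => by ring
    rw [h3, hp.2, Real.exp_neg, ← div_eq_mul_inv, div_le_one (Real.exp_pos _)]
    have h4 := Real.add_one_le_exp (l ^ 2)
    have h5 := mul_nonpos_of_nonneg_of_nonpos hl0 (hc t h)
    linarith
  refine le_trans (measure_mono fun h hh => ?_) (measure_le_pathSum_le D π hZ hstep T η)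
  have hh' : 2 * √(η * T) < pathSum Y h := hh
  have hsum : pathSum Z h = l * pathSum Y h - T * l ^ 2 := by
    simp [pathSum, Z, Finset.mul_sum]
  have hprod : l * √(η * T) = η := by
    rw [hl, ← Real.sqrt_mul (by positivity)]
    rw [show η / T * (η * T) = η ^ 2 by field_simp]
    exact Real.sqrt_sq hη.le
  have hTl : T * l ^ 2 = η := by rw [hl2]; field_simp
  change η ≤ pathSum Z h
  rw [hsum, hTl]
  nlinarith [mul_le_mul_of_nonneg_left hh'.le hl0]

/-! ### Concentration of the empirical means -/

/-- The sum of component `j` of the observations of arm `i`. -/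
def obsSum {t : ℕ} (h : Hist m d t) (j : Fin d) (i : Fin m) : ℝ :=
  ∑ s ∈ Finset.univ.filter fun s => (h s).1 = i, ((h s).2 j : ℝ)

theorem coord_mem (c : Fin d → I) (j : Fin d) : 0 ≤ (c j : ℝ) ∧ (c j : ℝ) ≤ 1 := (c j).2

theorem measurable_coord (j : Fin d) : Measurable fun c : Fin d → I => (c j : ℝ) :=
  measurable_subtype_coe.comp (measurable_pi_apply j)

theorem integrable_coord (i : Fin m) (j : Fin d) :
    Integrable (fun c : Fin d → I => (c j : ℝ)) (D i) :=
  integrable_of_abs_le_one (measurable_coord j) fun c => by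
    rw [abs_of_nonneg (coord_mem c j).1]; exact (coord_mem c j).2

theorem meanMatrix_mem (j : Fin d) (i : Fin m) : 0 ≤ meanMatrix D j i ∧ meanMatrix D j i ≤ 1 := by
  refine ⟨integral_nonneg fun c => (coord_mem c j).1, ?_⟩
  have := integral_mono (integrable_coord D i j) (integrable_const (1 : ℝ))
    fun c => (coord_mem c j).2
  simpa [meanMatrix] using this

theorem abs_coord_sub_meanMatrix_le (c : Fin d → I) (j : Fin d) (i : Fin m) :
    |(c j : ℝ) - meanMatrix D j i| ≤ 1 := by
  have h1 := coord_mem c j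
  have h2 := meanMatrix_mem D j i
  rw [abs_le]; constructor <;> linarith

theorem integral_coord_sub_meanMatrix (j : Fin d) (i : Fin m) :
    ∫ c, ((c j : ℝ) - meanMatrix D j i) ∂(D i) = 0 := by
  rw [integral_sub (integrable_coord D i j) (integrable_const _)]
  simp [meanMatrix]

/-- For x in [0,1] one has x² ≤ x, so (x − μ)² ≤ (1 − 2μ)x + μ², whose mean is μ − μ². -/
theorem integral_coord_sub_meanMatrix_sq_le (j : Fin d) (i : Fin m) :
    ∫ c, ((c j : ℝ) - meanMatrix D j i) ^ 2 ∂(D i) ≤ meanMatrix D j i := by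
  have hμ := meanMatrix_mem D j i
  set μ := meanMatrix D j i with hμd
  have hint : Integrable (fun c : Fin d → I => (1 - 2 * μ) * (c j : ℝ) + μ ^ 2) (D i) :=
    ((integrable_coord D i j).const_mul _).add (integrable_const _)
  have h1 := integral_mono_of_nonneg (μ := D i) (f := fun c => ((c j : ℝ) - μ) ^ 2)
    (ae_of_all _ fun c => sq_nonneg _) hint (ae_of_all _ fun c => by
      have := coord_mem c j
      simp only
      nlinarith)
  rw [integral_add ((integrable_coord D i j).const_mul _) (integrable_const _),
    integral_const_mul] at h1
  have h2 : ∫ c, (c j : ℝ) ∂(D i) = μ := rfl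
  rw [h2] at h1
  simp at h1
  nlinarith

/-- The increments vanish unless arm `i` is played, so the random number of plays needs no
conditioning. The drift l²μ compensates the variance. -/
theorem measure_le_arm_pathSum_le (i : Fin m) (j : Fin d) {l : ℝ} (hl : |l| ≤ 1) (t : ℕ) (η : ℝ) :
    histLaw D π t {h | η ≤ l * (obsSum h j i - plays h i * meanMatrix D j i) -
      l ^ 2 * (plays h i * meanMatrix D j i)} ≤ ENNReal.ofReal (Real.exp (-η)) := by
  classical
  set μ := meanMatrix D j i with hμd
  let Y : ∀ t, Hist m d t → Fin m × (Fin d → I) → ℝ := fun t h x =>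
    if x.1 = i then l * ((x.2 j : ℝ) - μ) - l ^ 2 * μ else 0
  have hY : ∀ t, Measurable fun y : Hist m d t × (Fin m × (Fin d → I)) => Y t y.1 y.2 := by
    intro t
    refine Measurable.ite ?_ ?_ measurable_const
    · exact (measurable_fst.comp measurable_snd) (measurableSet_singleton i)
    · exact ((((measurable_coord j).comp (measurable_snd.comp measurable_snd)).sub_const
        _).const_mul _).sub_const _
  have hstep : ∀ t h, ∑ i', ENNReal.ofReal (π.prob t h i') *
      ∫⁻ c, ENNReal.ofReal (Real.exp (Y t h (i', c))) ∂(D i') ≤ 1 := by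
    intro t h
    rw [← sum_ofReal_prob π t h]
    refine Finset.sum_le_sum fun i' _ => mul_le_of_le_one_right' ?_
    by_cases hi : i' = i
    · subst hi
      simp only [Y, if_true]
      refine (lintegral_exp_mul_sub_le (D i') ((measurable_coord j).sub_const μ)
        (fun c => abs_coord_sub_meanMatrix_le D c j i') hl _).trans ?_
      rw [integral_coord_sub_meanMatrix, ENNReal.ofReal_le_one, Real.exp_neg, ← div_eq_mul_inv,
        div_le_one (Real.exp_pos _)]
      have h1 := integral_coord_sub_meanMatrix_sq_le D j i'
      have h2 := Real.add_one_le_exp (l ^ 2 * μ)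
      nlinarith [mul_le_mul_of_nonneg_left h1 (sq_nonneg l)]
    · simp [Y, hi]
  refine le_trans (measure_mono fun h hh => ?_) (measure_le_pathSum_le D π hY hstep t η)
  change η ≤ pathSum Y h
  refine le_trans (le_of_eq_of_le rfl hh) (le_of_eq ?_)
  simp only [pathSum, Y, obsSum, plays]
  rw [← Finset.sum_filter, Finset.sum_sub_distrib, ← Finset.mul_sum, Finset.sum_sub_distrib]
  simp
  ring

/-- The best exponent depends on the number of plays, so that number is fixed here and a union bound
over it is taken later. -/
theorem measure_plays_eq_and_lt_le (i : Fin m) (j : Fin d) (n t : ℕ) {e η : ℝ} (he : |e| = 1)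
    (hη : 0 < η) :
    histLaw D π t {h | plays h i = n ∧ 2 * √(η * (n * meanMatrix D j i)) + 2 * η <
      e * (obsSum h j i - n * meanMatrix D j i)} ≤ ENNReal.ofReal (Real.exp (-η)) := by
  set a : ℝ := n * meanMatrix D j i with ha
  have ha0 : 0 ≤ a := mul_nonneg n.cast_nonneg (meanMatrix_mem D j i).1
  have he2 : e ^ 2 = 1 := by rw [← sq_abs, he, one_pow]
  -- When a ≤ η the exponent √(η/a) could exceed 1; exponent 1 already gives 2η − a ≥ η.
  rcases le_or_gt a η with hle | hlt
  · refine le_trans (measure_mono fun h hh => ?_)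
      (measure_le_arm_pathSum_le D π i j (l := e) he.le t η)
    obtain ⟨hn, hh⟩ := hh
    change η ≤ _
    rw [hn, ← ha, he2]
    linarith [Real.sqrt_nonneg (η * a)]
  · have ha1 : 0 < a := hη.trans hlt
    set r : ℝ := √(η / a) with hr
    have hr0 : 0 ≤ r := Real.sqrt_nonneg _
    have hr1 : r ≤ 1 := by
      rw [hr, Real.sqrt_le_one, div_le_one ha1]; exact hlt.le
    have hr2 : r ^ 2 * a = η := by
      rw [hr, Real.sq_sqrt (by positivity)]; field_simp
    have hprod : r * √(η * a) = η := by
      rw [hr, ← Real.sqrt_mul (by positivity), show η / a * (η * a) = η ^ 2 by field_simp]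
      exact Real.sqrt_sq hη.le
    have hl : |e * r| ≤ 1 := by rw [abs_mul, he, abs_of_nonneg hr0, one_mul]; exact hr1
    refine le_trans (measure_mono fun h hh => ?_)
      (measure_le_arm_pathSum_le D π i j hl t η)
    obtain ⟨hn, hh⟩ := hh
    change η ≤ _
    rw [hn, ← ha, mul_pow, he2, one_mul, hr2]
    nlinarith [mul_le_mul_of_nonneg_left hh.le hr0, mul_nonneg hr0 hη.le]

end

/-! ### Norms -/

theorem lqNorm_le_mul_lqNorm_one {d : ℕ} {q : ℝ≥0∞} (hq : 1 ≤ q) {x : Fin d → ℝ} {c : ℝ}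
    (hc : 0 ≤ c) (hx : ∀ j, |x j| ≤ c) : lqNorm q x ≤ c * lqNorm q (1 : Fin d → ℝ) := by
  have : Fact (1 ≤ q) := ⟨hq⟩
  have hsmul : c * lqNorm q (1 : Fin d → ℝ) = lqNorm q (c • (1 : Fin d → ℝ)) := by
    rw [lqNorm, lqNorm, WithLp.toLp_smul, norm_smul, Real.norm_of_nonneg hc]
  rw [hsmul, lqNorm, lqNorm]
  rcases eq_or_ne q ∞ with rfl | hq'
  · rw [PiLp.norm_eq_ciSup, PiLp.norm_eq_ciSup]
    refine ciSup_mono (Set.finite_range _).bddAbove fun j => ?_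
    simpa [abs_of_nonneg hc] using hx j
  · have hq0 : 0 < q.toReal := ENNReal.toReal_pos (zero_lt_one.trans_le hq).ne' hq'
    rw [PiLp.norm_eq_sum hq0, PiLp.norm_eq_sum hq0]
    refine Real.rpow_le_rpow (by positivity) (Finset.sum_le_sum fun j _ => ?_) (by positivity)
    refine Real.rpow_le_rpow (norm_nonneg _) ?_ hq0.le
    simpa [abs_of_nonneg hc] using hx j

theorem lqNorm_nonneg {d : ℕ} {q : ℝ≥0∞} (hq : 1 ≤ q) (x : Fin d → ℝ) : 0 ≤ lqNorm q x := by
  have : Fact (1 ≤ q) := ⟨hq⟩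
  exact norm_nonneg _

theorem one_le_lqNorm_one {d : ℕ} (hd : 0 < d) {q : ℝ≥0∞} (hq : 1 ≤ q) :
    1 ≤ lqNorm q (1 : Fin d → ℝ) := by
  have : Fact (1 ≤ q) := ⟨hq⟩
  have := PiLp.norm_apply_le (WithLp.toLp q (1 : Fin d → ℝ)) (⟨0, hd⟩ : Fin d)
  simpa [lqNorm] using this

/-! ### The unit cube -/

theorem mem_cube {d : ℕ} {x : Fin d → ℝ} : x ∈ cube d ↔ ∀ j, 0 ≤ x j ∧ x j ≤ 1 :=
  ⟨fun h j => ⟨h.1 j, h.2 j⟩, fun h => ⟨fun j => (h j).1, fun j => (h j).2⟩⟩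

theorem convex_cube (d : ℕ) : Convex ℝ (cube d) := convex_Icc 0 1

theorem mulVec_mem_cube {m d : ℕ} {W : Matrix (Fin d) (Fin m) ℝ}
    (hW : ∀ j i, 0 ≤ W j i ∧ W j i ≤ 1) {p : Fin m → ℝ} (hp : p ∈ stdSimplex ℝ (Fin m)) :
    W *ᵥ p ∈ cube d := by
  refine mem_cube.2 fun j => ⟨?_, ?_⟩
  · change 0 ≤ ∑ i, W j i * p i
    exact Finset.sum_nonneg fun i _ => mul_nonneg (hW j i).1 (hp.1 i)
  calc (W *ᵥ p) j = ∑ i, W j i * p i := rfl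
    _ ≤ ∑ i, 1 * p i :=
        Finset.sum_le_sum fun i _ => mul_le_mul_of_nonneg_right (hW j i).2 (hp.1 i)
    _ = 1 := by simp [hp.2]

theorem avgObs_mem_cube {m d t : ℕ} (h : Hist m d t) : avgObs h ∈ cube d := by
  refine mem_cube.2 fun j => ⟨div_nonneg (Finset.sum_nonneg fun s _ => (coord_mem _ j).1)
    t.cast_nonneg, div_le_one_of_le₀ ?_ t.cast_nonneg⟩
  exact (Finset.sum_le_sum fun s _ => (coord_mem (h s).2 j).2).trans (by simp)

/-! ### The Frank-Wolfe step -/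

theorem fderivWithin_apply_eq_grad_dotProduct {d : ℕ} (f : (Fin d → ℝ) → ℝ) (z v : Fin d → ℝ) :
    fderivWithin ℝ f (cube d) z v = grad f z ⬝ᵥ v := by
  conv_lhs => rw [pi_eq_sum_univ' v]
  rw [map_sum]
  refine Finset.sum_congr rfl fun j _ => ?_
  rw [map_smul, smul_eq_mul, mul_comm, grad]

/-- On the segment from `z` to `y`, the slope over [0,1] of a concave function is at most its
one-sided derivative at 0. This works at boundary points of the cube too. -/
theorem le_add_grad_dotProduct {d : ℕ} {f : (Fin d → ℝ) → ℝ} (hf : ConcaveOn ℝ (cube d) f)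
    (hd : DifferentiableOn ℝ f (cube d)) {y z : Fin d → ℝ} (hy : y ∈ cube d) (hz : z ∈ cube d) :
    f y ≤ f z + grad f z ⬝ᵥ (y - z) := by
  rw [← fderivWithin_apply_eq_grad_dotProduct]
  have hmaps : Set.MapsTo (AffineMap.lineMap z y : ℝ → Fin d → ℝ) (Set.Icc 0 1) (cube d) :=
    fun a ha => (convex_cube d).lineMap_mem hz hy ha
  have hline : HasDerivWithinAt (AffineMap.lineMap z y : ℝ → Fin d → ℝ) (y - z) (Set.Icc 0 1) 0 :=
    AffineMap.hasDerivWithinAt_lineMap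
  have hg : HasDerivWithinAt (f ∘ (AffineMap.lineMap z y : ℝ → Fin d → ℝ))
      (fderivWithin ℝ f (cube d) z (y - z)) (Set.Icc 0 1) 0 := by
    refine HasFDerivWithinAt.comp_hasDerivWithinAt (t := cube d) 0 ?_ hline hmaps
    simpa using (hd z hz).hasFDerivWithinAt
  have hconc : ConcaveOn ℝ (Set.Icc (0 : ℝ) 1)
      (f ∘ (AffineMap.lineMap z y : ℝ → Fin d → ℝ)) :=
    (hf.comp_affineMap _).subset hmaps (convex_Icc 0 1)
  have := hconc.slope_le_of_hasDerivWithinAt (x := 0) (y := 1) (by simp) (by simp)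
    zero_lt_one hg
  simp [slope_def_field] at this
  rw [map_sub]
  linarith

/-- A step of size α = 1/(n+1) contracts the gap by 1 − α at a cost of Cα²/2. Multiplying by n + 1
makes the recursion telescope. -/
theorem frankWolfe_step {d : ℕ} {f : (Fin d → ℝ) → ℝ} {C : ℝ} (hf : ConcaveOn ℝ (cube d) f)
    (hs : IsSmooth C f) {x y z : Fin d → ℝ} (hx : x ∈ cube d) (hy : y ∈ cube d) (hz : z ∈ cube d)
    (hmax : y ⬝ᵥ grad f z ≤ x ⬝ᵥ grad f z) (n : ℕ) :
    (n + 1 : ℝ) * (f y - f (z + (n + 1 : ℝ)⁻¹ • (x - z))) ≤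
      n * (f y - f z) + C / 2 * (1 / (n + 1 : ℝ)) := by
  have hn : (0 : ℝ) < n + 1 := by positivity
  have hα : (n + 1 : ℝ)⁻¹ ∈ Set.Icc (0 : ℝ) 1 :=
    ⟨by positivity, inv_le_one_of_one_le₀ (by linarith [n.cast_nonneg (α := ℝ)])⟩
  have h1 := hs.2 x hx z hz _ hα
  have h2 := le_add_grad_dotProduct hf hs.1 hy hz
  have h3 : grad f z ⬝ᵥ (y - z) ≤ grad f z ⬝ᵥ (x - z) := by
    rw [dotProduct_sub, dotProduct_sub, dotProduct_comm _ y, dotProduct_comm _ x]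
    linarith
  set α := (n + 1 : ℝ)⁻¹ with hαd
  have h4 : (n + 1 : ℝ) * α = 1 := mul_inv_cancel₀ hn.ne'
  have h5 : f z + α * (f y - f z) - C / 2 * α ^ 2 ≤ f (z + α • (x - z)) := by
    nlinarith [mul_le_mul_of_nonneg_left (h2.trans (add_le_add_right h3 (f z))) hα.1]
  have h6 := mul_le_mul_of_nonneg_left h5 hn.le
  have h7 : (n + 1 : ℝ) * (f z + α * (f y - f z) - C / 2 * α ^ 2) =
      (n + 1) * f z + (f y - f z) - C / 2 * α := by
    linear_combination (f y - f z - C / 2 * α) * h4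
  rw [one_div, ← hαd]
  linarith

theorem IsSmooth.nonneg {d : ℕ} {f : (Fin d → ℝ) → ℝ} {C : ℝ} (hs : IsSmooth C f) : 0 ≤ C := by
  have h0 : (0 : Fin d → ℝ) ∈ cube d := mem_cube.2 fun j => by simp
  have := hs.2 0 h0 0 h0 1 (by simp)
  simp at this
  linarith

/-! ### The algorithm as a Frank-Wolfe iteration -/

section Primal

variable {m d : ℕ} (A : EstPolicy m d)

/-- The estimated mean observation chosen after a history. -/
def EstPolicy.point {t : ℕ} (h : Hist m d t) : Fin d → ℝ := A.est t h *ᵥ A.prob t h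

theorem EstPolicy.avgEst_of_pos (x₀ : Fin d → ℝ) {t : ℕ} (ht : t ≠ 0) (h : Hist m d t) :
    A.avgEst x₀ h = (t : ℝ)⁻¹ • ∑ s : Fin t, A.point (pre s s.is_lt.le h) := by
  rw [EstPolicy.avgEst, if_neg ht]
  rfl

theorem EstPolicy.avgEst_succ (x₀ : Fin d → ℝ) {t : ℕ} (h : Hist m d (t + 1)) :
    A.avgEst x₀ h = A.avgEst x₀ (pre t t.le_succ h) +
      (t + 1 : ℝ)⁻¹ • (A.point (pre t t.le_succ h) - A.avgEst x₀ (pre t t.le_succ h)) := by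
  rw [A.avgEst_of_pos x₀ t.succ_ne_zero, Fin.sum_univ_castSucc]
  have hs : ∀ s : Fin t, A.point (pre s.castSucc s.castSucc.is_lt.le h) =
      A.point (pre s s.is_lt.le (pre t t.le_succ h)) := fun s => rfl
  have hl : A.point (pre (Fin.last t) (Fin.last t).is_lt.le h) = A.point (pre t t.le_succ h) := rfl
  simp_rw [hs, hl]
  have hn : (t + 1 : ℝ) ≠ 0 := by positivity
  -- In the first round the step size is 1, so the arbitrary x₀ cancels.
  rcases Nat.eq_zero_or_pos t with rfl | ht
  · simp
  · rw [A.avgEst_of_pos x₀ ht.ne']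
    have ht' : (t : ℝ) ≠ 0 := by positivity
    funext j
    simp only [Pi.smul_apply, Pi.add_apply, Pi.sub_apply, smul_eq_mul, Nat.cast_succ]
    field_simp
    ring

variable {A} {f : (Fin d → ℝ) → ℝ} {γ : ℝ} {x₀ : Fin d → ℝ} {T : ℕ}

theorem mem_of_mem_confSet {t : ℕ} {h : Hist m d t} {W : Matrix (Fin d) (Fin m) ℝ}
    (hW : W ∈ confSet γ h) (j : Fin d) (i : Fin m) : 0 ≤ W j i ∧ W j i ≤ 1 :=
  ⟨(le_max_left _ _).trans (hW j i).1, (hW j i).2.trans (min_le_left _ _)⟩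

theorem EstPolicy.IsPrimal.point_mem_cube (hA : A.IsPrimal f γ x₀ T) {t : ℕ} (ht : t < T)
    (h : Hist m d t) : A.point h ∈ cube d :=
  mulVec_mem_cube (mem_of_mem_confSet (hA t ht h).1) (A.prob_mem t h)

theorem EstPolicy.IsPrimal.avgEst_mem_cube (hA : A.IsPrimal f γ x₀ T) (hx₀ : x₀ ∈ cube d) {t : ℕ}
    (ht : t ≤ T) (h : Hist m d t) : A.avgEst x₀ h ∈ cube d := by
  induction t with
  | zero => simpa [EstPolicy.avgEst] using hx₀
  | succ t ih =>
    rw [A.avgEst_succ]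
    refine (convex_cube d).add_smul_sub_mem (ih (by omega) _) (hA.point_mem_cube ht _) ⟨?_, ?_⟩
    · positivity
    · exact inv_le_one_of_one_le₀ (by linarith [t.cast_nonneg (α := ℝ)])

/-- Optimism: `hconf` makes (p, M) a competitor in every round, so `frankWolfe_step` applies with y
= Mp. The weight t removes the gap at x₀. -/
theorem EstPolicy.IsPrimal.mul_sub_le (hA : A.IsPrimal f γ x₀ T) (hx₀ : x₀ ∈ cube d)
    (hf : ConcaveOn ℝ (cube d) f) {C : ℝ} (hs : IsSmooth C f) {M : Matrix (Fin d) (Fin m) ℝ}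
    {p : Fin m → ℝ} (hp : p ∈ stdSimplex ℝ (Fin m)) (hM : ∀ j i, 0 ≤ M j i ∧ M j i ≤ 1) {t : ℕ}
    (ht : t ≤ T) (h : Hist m d t) (hconf : ∀ s (hs : s < t), M ∈ confSet γ (pre s hs.le h)) :
    t * (f (M *ᵥ p) - f (A.avgEst x₀ h)) ≤ C / 2 * ∑ s ∈ Finset.range t, 1 / (s + 1 : ℝ) := by
  induction t with
  | zero => simp
  | succ t ih =>
    have h1 := ih (by omega) (pre t t.le_succ h) fun s hs => hconf s (by omega)
    have h2 := frankWolfe_step hf hs (hA.point_mem_cube ht (pre t t.le_succ h))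
      (mulVec_mem_cube hM hp) (hA.avgEst_mem_cube hx₀ (by omega) (pre t t.le_succ h))
      ((hA t ht _).2 p hp M (hconf t t.lt_succ_self)) t
    rw [← A.avgEst_succ] at h2
    rw [Finset.sum_range_succ, mul_add]
    push_cast
    linarith

/-- The harmonic sum is at most 1 + log t, and log t ≤ log₂ t because log 2 < 1. -/
theorem sum_range_one_div_le_logb {t : ℕ} (ht : t ≠ 0) :
    ∑ s ∈ Finset.range t, 1 / (s + 1 : ℝ) ≤ Real.logb 2 (2 * t) := by
  have h1 := harmonic_le_one_add_log t
  have h2 : ((harmonic t : ℚ) : ℝ) = ∑ s ∈ Finset.range t, 1 / (s + 1 : ℝ) := by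
    simp [harmonic]
  have h3 : Real.logb 2 (2 * t) = 1 + Real.logb 2 t := by
    rw [Real.logb_mul two_ne_zero (by positivity), Real.logb_self_eq_one one_lt_two]
  have h4 : Real.log t ≤ Real.logb 2 t := by
    rw [Real.logb, le_div_iff₀ (Real.log_pos one_lt_two)]
    have := Real.log_nonneg (x := (t : ℝ)) (by exact_mod_cast Nat.one_le_iff_ne_zero.2 ht)
    nlinarith [Real.log_two_lt_d9]
  linarith

theorem EstPolicy.IsPrimal.sub_le (hA : A.IsPrimal f γ x₀ T) (hx₀ : x₀ ∈ cube d)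
    (hf : ConcaveOn ℝ (cube d) f) {C : ℝ} (hs : IsSmooth C f) {M : Matrix (Fin d) (Fin m) ℝ}
    {p : Fin m → ℝ} (hp : p ∈ stdSimplex ℝ (Fin m)) (hM : ∀ j i, 0 ≤ M j i ∧ M j i ≤ 1)
    (hT : T ≠ 0) (h : Hist m d T) (hconf : ∀ s (hs : s < T), M ∈ confSet γ (pre s hs.le h)) :
    f (M *ᵥ p) - f (A.avgEst x₀ h) ≤ C * Real.logb 2 (2 * T) / (2 * T) := by
  have h1 := hA.mul_sub_le hx₀ hf hs hp hM le_rfl h hconf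
  have hC := hs.nonneg
  have hT' : (0 : ℝ) < T := by positivity
  rw [le_div_iff₀ (by positivity)]
  nlinarith [mul_le_mul_of_nonneg_left (sum_range_one_div_le_logb hT) hC]

end Primal

/-! ### Confidence bounds -/

section Confidence

variable {m d t : ℕ} {γ : ℝ}

theorem emp_eq (h : Hist m d t) (j : Fin d) (i : Fin m) :
    emp h j i = obsSum h j i / (plays h i + 1) := rfl

theorem obsSum_nonneg (h : Hist m d t) (j : Fin d) (i : Fin m) : 0 ≤ obsSum h j i :=
  Finset.sum_nonneg fun _ _ => (coord_mem _ j).1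

theorem obsSum_le_plays (h : Hist m d t) (j : Fin d) (i : Fin m) : obsSum h j i ≤ plays h i := by
  refine (Finset.sum_le_sum fun s _ => (coord_mem (h s).2 j).2).trans ?_
  simp [plays]

theorem emp_mem (h : Hist m d t) (j : Fin d) (i : Fin m) : 0 ≤ emp h j i ∧ emp h j i ≤ 1 := by
  rw [emp_eq]
  refine ⟨div_nonneg (obsSum_nonneg h j i) (by positivity), div_le_one_of_le₀ ?_ (by positivity)⟩
  linarith [obsSum_le_plays h j i]

theorem rad_div {S N : ℝ} (hN : 0 < N) : rad γ (S / N) N = (√(γ * S) + γ) / N := by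
  rw [rad, add_div]
  congr 1
  rw [show γ * (S / N) / N = γ * S / N ^ 2 by field_simp, Real.sqrt_div' _ (sq_nonneg N),
    Real.sqrt_sq hN.le]

/-- The deviation is controlled by the true mean, while the radius uses the observed sum S; `key`
exchanges one for the other. Dividing by n + 1 instead of n costs μ ≤ 1 ≤ γ. -/
theorem abs_sub_le_of_deviation {n μ S : ℝ} (hn : 0 ≤ n) (hμ0 : 0 ≤ μ) (hμ1 : μ ≤ 1) (hS : 0 ≤ S)
    (hγ : 1 ≤ γ) (h1 : S - n * μ ≤ 2 * √(γ / 8 * (n * μ)) + 2 * (γ / 8))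
    (h2 : n * μ - S ≤ 2 * √(γ / 8 * (n * μ)) + 2 * (γ / 8)) :
    |S - (n + 1) * μ| ≤ 2 * (√(γ * S) + γ) := by
  have ha : 0 ≤ n * μ := mul_nonneg hn hμ0
  have hη : 0 ≤ γ / 8 := by linarith
  have hγ' : γ = 8 * (γ / 8) := by ring
  set a := n * μ
  set η := γ / 8
  have hγS : √(η * S) ≤ √(γ * S) := Real.sqrt_le_sqrt (by nlinarith)
  rw [Real.sqrt_mul hη] at h1 h2 hγS
  have ea := Real.sq_sqrt ha
  have eη := Real.sq_sqrt hη
  have eS := Real.sq_sqrt hS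
  have ua := Real.sqrt_nonneg a
  have uη := Real.sqrt_nonneg η
  have uS := Real.sqrt_nonneg S
  -- Completing the square in `h2` gives (√a − √η)² ≤ S + 3η.
  have key : √a ≤ √S + 3 * √η := by
    have : (√a - √η) ^ 2 ≤ (√S + 2 * √η) ^ 2 := by nlinarith [mul_nonneg uη uS]
    have := abs_le_of_sq_le_sq' this (by positivity)
    linarith [this.2]
  have := mul_le_mul_of_nonneg_left key uη
  rw [abs_le]
  constructor
  · nlinarith
  · rcases le_or_gt S a with hSa | hSa
    · nlinarith [Real.sqrt_nonneg (γ * S)]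
    · have := mul_le_mul_of_nonneg_left (Real.sqrt_le_sqrt hSa.le) uη
      nlinarith

theorem mem_confSet_of_deviation {M : Matrix (Fin d) (Fin m) ℝ}
    (hM : ∀ j i, 0 ≤ M j i ∧ M j i ≤ 1) (hγ : 1 ≤ γ) (h : Hist m d t)
    (h1 : ∀ j i, obsSum h j i - plays h i * M j i ≤
      2 * √(γ / 8 * (plays h i * M j i)) + 2 * (γ / 8))
    (h2 : ∀ j i, plays h i * M j i - obsSum h j i ≤
      2 * √(γ / 8 * (plays h i * M j i)) + 2 * (γ / 8)) : M ∈ confSet γ h := by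
  intro j i
  have hN : (0 : ℝ) < plays h i + 1 := by positivity
  have h3 := abs_le.1 (abs_sub_le_of_deviation (plays h i).cast_nonneg (hM j i).1 (hM j i).2
    (obsSum_nonneg h j i) hγ (h1 j i) (h2 j i))
  rw [lcb, ucb, emp_eq, rad_div hN]
  refine ⟨max_le (hM j i).1 ?_, le_min (hM j i).2 ?_⟩
  · rw [← mul_div_assoc, ← sub_div, div_le_iff₀ hN]
    linarith
  · rw [← mul_div_assoc, ← add_div, le_div_iff₀ hN]
    linarith

/-- An upper bound on the width of the confidence intervals of an arm. -/
def width (γ : ℝ) (h : Hist m d t) (i : Fin m) : ℝ := min 1 (8 * √(γ / (plays h i + 1)))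

theorem width_nonneg (h : Hist m d t) (i : Fin m) : 0 ≤ width γ h i :=
  le_min zero_le_one (by positivity)

theorem width_le_one (h : Hist m d t) (i : Fin m) : width γ h i ≤ 1 := min_le_left _ _

/-- With r = √(γ/N), the interval has length at most 4 rad ≤ 4(r + r²) ≤ 8r when r ≤ 1; when r > 1
the trivial bound 1 suffices. -/
theorem ucb_sub_lcb_le_width (hγ : 0 ≤ γ) (h : Hist m d t) (j : Fin d) (i : Fin m) :
    ucb γ h j i - lcb γ h j i ≤ width γ h i := by
  have hN : (0 : ℝ) < plays h i + 1 := by positivity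
  have hu1 : ucb γ h j i ≤ 1 := min_le_left _ _
  have hu2 : ucb γ h j i ≤ _ := min_le_right _ _
  have hl1 : 0 ≤ lcb γ h j i := le_max_left _ _
  have hl2 : _ ≤ lcb γ h j i := le_max_right _ _
  refine le_min (by linarith) ?_
  have he := emp_mem h j i
  set N : ℝ := plays h i + 1
  set r := √(γ / N) with hr
  have hr0 : 0 ≤ r := Real.sqrt_nonneg _
  have hr2 : r ^ 2 = γ / N := Real.sq_sqrt (by positivity)
  rcases le_or_gt r 1 with h1 | h1
  · have hle : √(γ * emp h j i / N) ≤ r :=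
      Real.sqrt_le_sqrt (div_le_div_of_nonneg_right (mul_le_of_le_one_right hγ he.2) hN.le)
    have : rad γ (emp h j i) N ≤ 2 * r := by
      rw [rad, ← hr2]; nlinarith
    linarith
  · linarith

theorem abs_sub_le_width {W W' : Matrix (Fin d) (Fin m) ℝ} (hγ : 0 ≤ γ) {h : Hist m d t}
    (hW : W ∈ confSet γ h) (hW' : W' ∈ confSet γ h) (j : Fin d) (i : Fin m) :
    |W j i - W' j i| ≤ width γ h i := by
  have := ucb_sub_lcb_le_width hγ h j i
  have h1 := hW j i
  have h2 := hW' j i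
  rw [abs_le]
  constructor <;> linarith [h1.1, h1.2, h2.1, h2.2]

/-! ### Play counts and the total width -/

theorem plays_eq_sum (h : Hist m d t) (i : Fin m) :
    plays h i = ∑ s, if (h s).1 = i then 1 else 0 := by
  rw [plays, Finset.card_filter]

theorem plays_extend (h : Hist m d t) (x : Fin m × (Fin d → I)) (i : Fin m) :
    plays (extend h x) i = plays h i + if x.1 = i then 1 else 0 := by
  rw [plays_eq_sum, plays_eq_sum, Fin.sum_univ_castSucc]
  simp

theorem sum_plays (h : Hist m d t) : ∑ i, plays h i = t := by
  simp_rw [plays_eq_sum]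
  rw [Finset.sum_comm]
  simp

theorem measurable_plays (i : Fin m) : Measurable fun h : Hist m d t => plays h i := by
  simp_rw [plays_eq_sum]
  refine Finset.measurable_sum _ fun s _ => Measurable.ite ?_ measurable_const measurable_const
  exact (measurable_fst.comp (measurable_pi_apply s)) (measurableSet_singleton i)

theorem sqrt_div_add_one_le (hγ : 0 ≤ γ) (k : ℕ) :
    √(γ / (k + 1)) ≤ 2 * (√(γ * (k + 1)) - √(γ * k)) := by
  have hk : (0 : ℝ) < k + 1 := by positivity
  rw [Real.sqrt_div hγ, Real.sqrt_mul hγ, Real.sqrt_mul hγ, div_le_iff₀ (Real.sqrt_pos.2 hk)]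
  have h1 := Real.sq_sqrt hk.le
  have h2 := Real.sq_sqrt (k.cast_nonneg (α := ℝ))
  have h3 : 1 ≤ 2 * (√(k + 1 : ℝ) - √k) * √(k + 1 : ℝ) := by
    nlinarith [sq_nonneg (√(k + 1 : ℝ) - √k)]
  nlinarith [mul_le_mul_of_nonneg_left h3 (Real.sqrt_nonneg γ)]

/-- A play of an arm raises only that arm's term on the right, and by `sqrt_div_add_one_le` the
increase pays for the width; 16 is 8 · 2. -/
theorem pathSum_width_le_sum_sqrt (hγ : 0 ≤ γ) (h : Hist m d t) :
    pathSum (fun _ h x => width γ h x.1) h ≤ 16 * ∑ i, √(γ * plays h i) := by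
  induction t, h using extend_induction with
  | h0 h => simp only [pathSum, Finset.univ_eq_empty, Finset.sum_empty]; positivity
  | hs t h x ih =>
    rw [pathSum_extend]
    have h1 : ∑ i, √(γ * plays (extend h x) i) = ∑ i, √(γ * plays h i) +
        (√(γ * (plays h x.1 + 1)) - √(γ * plays h x.1)) := by
      rw [← sub_eq_iff_eq_add', ← Finset.sum_sub_distrib, Finset.sum_eq_single x.1]
      · simp [plays_extend]
      · intro i _ hi
        simp [plays_extend, hi.symm]
      · simp
    have h2 : width γ h x.1 ≤ 8 * √(γ / (plays h x.1 + 1)) := min_le_right _ _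
    have h3 := sqrt_div_add_one_le hγ (plays h x.1)
    rw [h1]
    linarith

/-- Cauchy-Schwarz over the arms, whose play counts add up to t. -/
theorem pathSum_width_le (hγ : 0 ≤ γ) (h : Hist m d t) :
    pathSum (fun _ h x => width γ h x.1) h ≤ 16 * √(γ * m * t) := by
  refine (pathSum_width_le_sum_sqrt hγ h).trans (mul_le_mul_of_nonneg_left ?_ (by norm_num))
  refine Real.le_sqrt_of_sq_le ?_
  have h1 := sq_sum_le_card_mul_sum_sq (s := Finset.univ) (f := fun i => √(γ * plays h i))
  have h2 : ∑ i, √(γ * plays h i) ^ 2 = γ * t := by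
    have h3 : (t : ℝ) = ∑ i, (plays h i : ℝ) := by rw [← Nat.cast_sum, sum_plays]
    rw [h3, Finset.mul_sum]
    exact Finset.sum_congr rfl fun i _ => Real.sq_sqrt (by positivity)
  rw [h2] at h1
  simp only [Finset.card_univ, Fintype.card_fin] at h1
  linarith

end Confidence

section

variable {m d : ℕ} (D : Fin m → Measure (Fin d → I)) [∀ i, IsProbabilityMeasure (D i)]

/-! ### The optimal dynamic solution -/

theorem integral_histLaw_succ (π : Policy m d) {t : ℕ} {F : Hist m d (t + 1) → ℝ}
    (hF : Measurable F) {b : ℝ} (h0 : ∀ h, 0 ≤ F h) (hb : ∀ h, F h ≤ b) :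
    ∫ h, F h ∂(histLaw D π (t + 1)) =
      ∫ h, ∑ i, π.prob t h i * ∫ c, F (extend h (i, c)) ∂(D i) ∂(histLaw D π t) := by
  have hmeas : ∀ i, Measurable fun h => ∫ c, F (extend h (i, c)) ∂(D i) := fun i =>
    ((hF.comp (measurable_extend_arm i)).stronglyMeasurable.integral_prod_right').measurable
  rw [integral_eq_lintegral_of_nonneg_ae (ae_of_all _ h0) hF.aestronglyMeasurable,
    lintegral_histLaw_succ D π t hF.ennreal_ofReal, integral_eq_lintegral_of_nonneg_ae]
  · congr 1
    refine lintegral_congr fun h => ?_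
    have hp := π.prob_mem t h
    rw [ENNReal.ofReal_sum_of_nonneg fun i _ =>
      mul_nonneg (hp.1 i) (integral_nonneg fun c => h0 _)]
    refine Finset.sum_congr rfl fun i _ => ?_
    rw [ENNReal.ofReal_mul (hp.1 i), ofReal_integral_eq_lintegral_ofReal _
      (ae_of_all _ fun c => h0 _)]
    refine Integrable.of_bound (hF.comp (measurable_extend_right h i)).aestronglyMeasurable b
      (ae_of_all _ fun c => ?_)
    rw [Real.norm_of_nonneg (h0 _)]
    exact hb _
  · exact ae_of_all _ fun h => Finset.sum_nonneg fun i _ =>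
      mul_nonneg ((π.prob_mem t h).1 i) (integral_nonneg fun c => h0 _)
  · exact (Finset.measurable_sum _ fun i _ =>
      (measurable_prob π t i).mul (hmeas i)).aestronglyMeasurable

theorem prob_le_one (π : Policy m d) {t : ℕ} (h : Hist m d t) (i : Fin m) : π.prob t h i ≤ 1 := by
  rw [← (π.prob_mem t h).2]
  exact Finset.single_le_sum (fun i _ => (π.prob_mem t h).1 i) (Finset.mem_univ i)

theorem integrable_prob (π : Policy m d) (t : ℕ) (i : Fin m) :
    Integrable (fun h => π.prob t h i) (histLaw D π t) :=
  integrable_of_abs_le_one (measurable_prob π t i) fun h => by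
    rw [abs_of_nonneg ((π.prob_mem t h).1 i)]; exact prob_le_one π h i

theorem measurable_sum_coord (t : ℕ) (j : Fin d) :
    Measurable fun h : Hist m d t => ∑ s, ((h s).2 j : ℝ) :=
  Finset.measurable_sum _ fun s _ =>
    (measurable_coord j).comp (measurable_snd.comp (measurable_pi_apply s))

theorem sum_coord_nonneg {t : ℕ} (h : Hist m d t) (j : Fin d) : 0 ≤ ∑ s, ((h s).2 j : ℝ) :=
  Finset.sum_nonneg fun _ _ => (coord_mem _ j).1

theorem sum_coord_le {t : ℕ} (h : Hist m d t) (j : Fin d) : ∑ s, ((h s).2 j : ℝ) ≤ t :=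
  (Finset.sum_le_sum fun s _ => (coord_mem (h s).2 j).2).trans (by simp)

theorem integrable_sum_coord (π : Policy m d) (t : ℕ) (j : Fin d) :
    Integrable (fun h : Hist m d t => ∑ s, ((h s).2 j : ℝ)) (histLaw D π t) :=
  Integrable.of_bound (measurable_sum_coord t j).aestronglyMeasurable t (ae_of_all _ fun h => by
    rw [Real.norm_of_nonneg (sum_coord_nonneg h j)]; exact sum_coord_le h j)

theorem exists_integral_sum_coord_eq (π : Policy m d) (t : ℕ) :
    ∃ a : Fin m → ℝ, (∀ i, 0 ≤ a i) ∧ ∑ i, a i = t ∧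
      ∀ j, ∫ h, ∑ s, ((h s).2 j : ℝ) ∂(histLaw D π t) = ∑ i, meanMatrix D j i * a i := by
  induction t with
  | zero => exact ⟨0, by simp, by simp, by simp⟩
  | succ t ih =>
    obtain ⟨a, ha0, ha1, ha2⟩ := ih
    -- The witness is the expected number of plays of each arm.
    refine ⟨fun i => a i + ∫ h, π.prob t h i ∂(histLaw D π t), fun i => ?_, ?_, fun j => ?_⟩
    · exact add_nonneg (ha0 i) (integral_nonneg fun h => (π.prob_mem t h).1 i)
    · rw [Finset.sum_add_distrib, ha1, ← integral_finsetSum _ fun i _ => integrable_prob D π t i]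
      simp [fun h => (π.prob_mem t h).2]
    · rw [integral_histLaw_succ D π (measurable_sum_coord (t + 1) j)
        (fun h => sum_coord_nonneg h j) (fun h => sum_coord_le h j)]
      have hstep : ∀ h : Hist m d t, ∑ i, π.prob t h i *
          ∫ c, ∑ s, ((extend h (i, c) s).2 j : ℝ) ∂(D i) =
          ∑ s, ((h s).2 j : ℝ) + ∑ i, meanMatrix D j i * π.prob t h i := by
        intro h
        have h1 : ∀ i, ∫ c, ∑ s, ((extend h (i, c) s).2 j : ℝ) ∂(D i) =
            ∑ s, ((h s).2 j : ℝ) + meanMatrix D j i := by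
          intro i
          simp only [Fin.sum_univ_castSucc, extend_castSucc, extend_last]
          rw [integral_add (integrable_const _) (integrable_coord D i j)]
          simp [meanMatrix]
        simp_rw [h1, mul_add, Finset.sum_add_distrib, ← Finset.sum_mul, (π.prob_mem t h).2,
          one_mul, mul_comm]
      simp_rw [hstep]
      rw [integral_add (integrable_sum_coord D π t j) (integrable_finsetSum _ fun i _ =>
        (integrable_prob D π t i).const_mul _), ha2, integral_finsetSum _ fun i _ =>
        (integrable_prob D π t i).const_mul _, ← Finset.sum_add_distrib]
      refine Finset.sum_congr rfl fun i _ => ?_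
      rw [integral_const_mul, mul_add]

theorem exists_integral_avgObs_eq (π : Policy m d) {T : ℕ} (hT : T ≠ 0) :
    ∃ p ∈ stdSimplex ℝ (Fin m), ∫ h, avgObs h ∂(histLaw D π T) = meanMatrix D *ᵥ p := by
  obtain ⟨a, ha0, ha1, ha2⟩ := exists_integral_sum_coord_eq D π T
  have hT' : (T : ℝ) ≠ 0 := by exact_mod_cast hT
  refine ⟨fun i => a i / T, ⟨fun i => div_nonneg (ha0 i) T.cast_nonneg, ?_⟩, ?_⟩
  · rw [← Finset.sum_div, ha1, div_self hT']
  · funext j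
    rw [eval_integral (f := avgObs) fun j => (integrable_sum_coord D π T j).div_const _]
    simp only [avgObs]
    rw [integral_div, ha2, Finset.sum_div]
    exact Finset.sum_congr rfl fun i _ => mul_div_assoc _ _ _

theorem measurable_avgObs (t : ℕ) : Measurable (avgObs : Hist m d t → Fin d → ℝ) :=
  measurable_pi_iff.2 fun j => (measurable_sum_coord t j).div_const _

/-- Jensen's inequality: f at the expected average, which is Vp for some p, dominates the expected
reward of the policy. -/
theorem opt_le {f : (Fin d → ℝ) → ℝ} (hf : ConcaveOn ℝ (cube d) f)
    (hcont : ContinuousOn f (cube d)) (hrange : ∀ x ∈ cube d, f x ∈ Set.Icc (0 : ℝ) 1) {T : ℕ}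
    (hT : T ≠ 0) {B : ℝ} (hB : 0 ≤ B)
    (hle : ∀ p ∈ stdSimplex ℝ (Fin m), f (meanMatrix D *ᵥ p) ≤ B) : opt D f T ≤ B := by
  refine Real.iSup_le (fun π => ?_) hB
  obtain ⟨p, hp, hpe⟩ := exists_integral_avgObs_eq D π hT
  -- Nothing is known about `f` off the cube, so measurability is obtained after clamping the
  -- argument to the cube.
  have hclamp : Continuous fun x : Fin d → ℝ => f ((x ⊔ 0) ⊓ 1) :=
    hcont.comp_continuous (continuous_pi fun j =>
      ((continuous_apply j).max continuous_const).min continuous_const) fun x => ⟨le_inf le_sup_right zero_le_one, inf_le_right⟩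
  have hmeas : Measurable fun h : Hist m d T => f (avgObs h) := by
    have heq : (fun h : Hist m d T => f (avgObs h)) = fun h => f ((avgObs h ⊔ 0) ⊓ 1) := by
      funext h
      have hm := avgObs_mem_cube h
      rw [sup_of_le_left hm.1, inf_of_le_left hm.2]
    rw [heq]
    exact hclamp.measurable.comp (measurable_avgObs T)
  have hint : Integrable (f ∘ avgObs) (histLaw D π T) :=
    integrable_of_abs_le_one hmeas fun h => by
      have := hrange _ (avgObs_mem_cube h)
      rw [Function.comp_apply, abs_of_nonneg this.1]; exact this.2
  have hint' : Integrable avgObs (histLaw D π T) :=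
    Integrable.of_eval fun j => (integrable_sum_coord D π T j).div_const _
  have := hf.le_map_integral hcont isClosed_Icc
    (ae_of_all _ fun h => avgObs_mem_cube h) hint' hint
  rw [hpe] at this
  exact this.trans (hle p hp)

/-! ### The favourable event -/

/-- The deviation of the expected mean of the chosen arm from the observation, in component `j`. -/
def obsDeviation (π : Policy m d) (j : Fin d) (t : ℕ) (h : Hist m d t)
    (x : Fin m × (Fin d → I)) : ℝ :=
  (meanMatrix D *ᵥ π.prob t h) j - (x.2 j : ℝ)

/-- The deviation of the expected width of the chosen arm from its width. -/
def widthDeviation (π : Policy m d) (γ : ℝ) (t : ℕ) (h : Hist m d t)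
    (x : Fin m × (Fin d → I)) : ℝ :=
  ∑ i, π.prob t h i * width γ h i - width γ h x.1

/-- The favourable event of the analysis: all empirical means, and both martingales, are
concentrated. -/
def goodEvent (π : Policy m d) (γ η : ℝ) (T : ℕ) : Set (Hist m d T) :=
  {h | (∀ s : Fin T, ∀ i j, ∀ e : Bool,
      (cond e 1 (-1) : ℝ) * (obsSum (pre s s.is_lt.le h) j i -
        plays (pre s s.is_lt.le h) i * meanMatrix D j i) ≤
        2 * √(η * (plays (pre s s.is_lt.le h) i * meanMatrix D j i)) + 2 * η) ∧
    (∀ j, ∀ e : Bool, (cond e 1 (-1) : ℝ) * pathSum (obsDeviation D π j) h ≤ 2 * √(η * T)) ∧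
    pathSum (widthDeviation π γ) h ≤ 2 * √(η * T)}

theorem meanMatrix_mulVec_prob_mem (π : Policy m d) {t : ℕ} (h : Hist m d t) (j : Fin d) :
    0 ≤ (meanMatrix D *ᵥ π.prob t h) j ∧ (meanMatrix D *ᵥ π.prob t h) j ≤ 1 :=
  mem_cube.1 (mulVec_mem_cube (meanMatrix_mem D) (π.prob_mem t h)) j

theorem measure_lt_pathSum_obsDeviation_le (π : Policy m d) (j : Fin d) {e : ℝ} (he : |e| = 1)
    (T : ℕ) {η : ℝ} (hη : 0 < η) :
    histLaw D π T {h | 2 * √(η * T) < e * pathSum (obsDeviation D π j) h} ≤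
      ENNReal.ofReal (Real.exp (-η)) := by
  have hsum : ∀ h : Hist m d T, e * pathSum (obsDeviation D π j) h =
      pathSum (fun t h x => e * obsDeviation D π j t h x) h := fun h => Finset.mul_sum _ _ _
  simp_rw [hsum]
  refine measure_lt_pathSum_le_of_centered D π (fun t => ?_) (fun t h x => ?_) (fun t h => ?_) T hη
  · refine Measurable.const_mul (Measurable.sub ?_ ?_) _
    · simp only [Matrix.mulVec, dotProduct]
      exact Finset.measurable_sum _ fun i _ =>
        ((measurable_prob π t i).comp measurable_fst).const_mul _
    · exact (measurable_coord j).comp (measurable_snd.comp measurable_snd)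
  · have h1 := meanMatrix_mulVec_prob_mem D π h j
    have h2 := coord_mem x.2 j
    rw [abs_mul, he, one_mul, obsDeviation, abs_le]
    constructor <;> linarith
  · have h1 : ∀ i, ∫ c, e * obsDeviation D π j t h (i, c) ∂(D i) =
        e * ((meanMatrix D *ᵥ π.prob t h) j - meanMatrix D j i) := fun i => by
      simp only [obsDeviation]
      rw [integral_const_mul, integral_sub (integrable_const _) (integrable_coord D i j)]
      simp [meanMatrix]
    have h2 : ∑ i, π.prob t h i * meanMatrix D j i = (meanMatrix D *ᵥ π.prob t h) j :=
      Finset.sum_congr rfl fun i _ => mul_comm _ _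
    simp_rw [h1, mul_left_comm _ e, ← Finset.mul_sum, mul_sub, Finset.sum_sub_distrib,
      ← Finset.sum_mul, h2, (π.prob_mem t h).2]
    simp

theorem sum_prob_mul_width_mem (π : Policy m d) (γ : ℝ) {t : ℕ} (h : Hist m d t) :
    0 ≤ ∑ i, π.prob t h i * width γ h i ∧ ∑ i, π.prob t h i * width γ h i ≤ 1 := by
  have hp := π.prob_mem t h
  refine ⟨Finset.sum_nonneg fun i _ => mul_nonneg (hp.1 i) (width_nonneg h i), ?_⟩
  rw [← hp.2]
  exact Finset.sum_le_sum fun i _ => mul_le_of_le_one_right (hp.1 i) (width_le_one h i)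

theorem measurable_width (γ : ℝ) (t : ℕ) (i : Fin m) :
    Measurable fun h : Hist m d t => width γ h i := by
  have h1 : Measurable fun n : ℕ => min 1 (8 * √(γ / ((n : ℝ) + 1))) := measurable_of_countable _
  exact h1.comp (measurable_plays i)

theorem measure_lt_pathSum_widthDeviation_le (π : Policy m d) (γ : ℝ) (T : ℕ) {η : ℝ}
    (hη : 0 < η) :
    histLaw D π T {h | 2 * √(η * T) < pathSum (widthDeviation π γ) h} ≤
      ENNReal.ofReal (Real.exp (-η)) := by
  refine measure_lt_pathSum_le_of_centered D π (fun t => ?_) (fun t h x => ?_) (fun t h => ?_) T hη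
  · refine Measurable.sub ?_ ?_
    · exact Finset.measurable_sum _ fun i _ => ((measurable_prob π t i).comp measurable_fst).mul
        ((measurable_width γ t i).comp measurable_fst)
    · have h1 : Measurable fun y : Hist m d t × Fin m => width γ y.1 y.2 :=
        measurable_from_prod_countable_left fun i => measurable_width γ t i
      have h2 : Measurable fun y : Hist m d t × (Fin m × (Fin d → I)) => (y.1, y.2.1) :=
        measurable_fst.prodMk (measurable_fst.comp measurable_snd)
      have h3 := h1.comp h2
      exact h3
  · have h1 := sum_prob_mul_width_mem π γ h
    have h2 := width_nonneg (γ := γ) h x.1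
    have h3 := width_le_one (γ := γ) h x.1
    rw [widthDeviation, abs_le]
    constructor <;> linarith
  · simp only [widthDeviation, integral_const, probReal_univ, one_smul, mul_sub,
      Finset.sum_sub_distrib, ← Finset.sum_mul, (π.prob_mem t h).2]
    simp

theorem plays_le {t : ℕ} (h : Hist m d t) (i : Fin m) : plays h i ≤ t := by
  exact (Finset.single_le_sum (f := plays h) (fun _ _ => Nat.zero_le _)
    (Finset.mem_univ i)).trans_eq (sum_plays h)

theorem measure_compl_goodEvent_le (π : Policy m d) (γ : ℝ) {η : ℝ} (hη : 0 < η) (T : ℕ) :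
    histLaw D π T (goodEvent D π γ η T)ᶜ ≤
      ENNReal.ofReal ((2 * T ^ 2 * m * d + 2 * d + 1) * Real.exp (-η)) := by
  have he : ∀ e : Bool, |(cond e 1 (-1) : ℝ)| = 1 := by rintro (_ | _) <;> simp
  -- The indices are round, play count, arm, component and sign. Before a round s < T an arm has
  -- fewer than T plays, so counts range over `Fin T`.
  let B₁ : Fin T × Fin T × Fin m × Fin d × Bool → Set (Hist m d T) := fun k =>
    pre k.1 k.1.is_lt.le ⁻¹' {h | plays h k.2.2.1 = (k.2.1 : ℕ) ∧
      2 * √(η * ((k.2.1 : ℕ) * meanMatrix D k.2.2.2.1 k.2.2.1)) + 2 * η <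
        (cond k.2.2.2.2 1 (-1) : ℝ) * (obsSum h k.2.2.2.1 k.2.2.1 -
          (k.2.1 : ℕ) * meanMatrix D k.2.2.2.1 k.2.2.1)}
  let B₂ : Fin d × Bool → Set (Hist m d T) := fun k =>
    {h | 2 * √(η * T) < (cond k.2 1 (-1) : ℝ) * pathSum (obsDeviation D π k.1) h}
  let B₃ : Set (Hist m d T) := {h | 2 * √(η * T) < pathSum (widthDeviation π γ) h}
  have hsub : (goodEvent D π γ η T)ᶜ ⊆ ((⋃ k, B₁ k) ∪ ⋃ k, B₂ k) ∪ B₃ := by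
    intro h hh
    by_contra hcon
    simp only [Set.mem_union, Set.mem_iUnion, not_or, not_exists] at hcon
    obtain ⟨⟨h1, h2⟩, h3⟩ := hcon
    refine hh ⟨fun s i j e => ?_, fun j e => not_lt.1 (h2 (j, e)), not_lt.1 h3⟩
    have hlt : plays (pre s s.is_lt.le h) i < T := (plays_le _ i).trans_lt s.is_lt
    exact not_lt.1 fun hlt' => h1 (s, ⟨_, hlt⟩, i, j, e) ⟨rfl, hlt'⟩
  set ε := ENNReal.ofReal (Real.exp (-η)) with hε
  have hB₁ : histLaw D π T (⋃ k, B₁ k) ≤ (2 * T ^ 2 * m * d : ℕ) * ε := by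
    refine (measure_iUnion_fintype_le _ _).trans ((Finset.sum_le_sum fun k _ =>
      (measure_pre_le D π k.1.is_lt.le _).trans
        (measure_plays_eq_and_lt_le D π k.2.2.1 k.2.2.2.1 k.2.1 k.1 (he k.2.2.2.2) hη)).trans ?_)
    rw [Finset.sum_const, nsmul_eq_mul, Finset.card_univ]
    simp only [Fintype.card_prod, Fintype.card_fin, Fintype.card_bool]
    rw [show T * (T * (m * (d * 2))) = 2 * T ^ 2 * m * d by ring]
  have hB₂ : histLaw D π T (⋃ k, B₂ k) ≤ (2 * d : ℕ) * ε := by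
    refine (measure_iUnion_fintype_le _ _).trans ((Finset.sum_le_sum fun k _ =>
      measure_lt_pathSum_obsDeviation_le D π k.1 (he k.2) T hη).trans ?_)
    rw [Finset.sum_const, nsmul_eq_mul, Finset.card_univ]
    simp only [Fintype.card_prod, Fintype.card_fin, Fintype.card_bool]
    rw [mul_comm d 2]
  have hB₃ : histLaw D π T B₃ ≤ ε := measure_lt_pathSum_widthDeviation_le D π γ T hη
  calc histLaw D π T (goodEvent D π γ η T)ᶜ
      ≤ (2 * T ^ 2 * m * d : ℕ) * ε + (2 * d : ℕ) * ε + ε :=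
        (measure_mono hsub).trans ((measure_union_le _ _).trans
          (add_le_add ((measure_union_le _ _).trans (add_le_add hB₁ hB₂)) hB₃))
    _ = (2 * T ^ 2 * m * d + 2 * d + 1 : ℕ) * ε := by push_cast; ring
    _ = _ := by
        rw [hε, ← ENNReal.ofReal_natCast, ← ENNReal.ofReal_mul (Nat.cast_nonneg _)]
        push_cast
        rfl

/-! ### Consequences of the favourable event -/

variable {D} {A : EstPolicy m d} {f : (Fin d → ℝ) → ℝ} {γ : ℝ} {x₀ : Fin d → ℝ} {T : ℕ}

theorem meanMatrix_mem_confSet (hγ : 1 ≤ γ) {h : Hist m d T}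
    (hh : h ∈ goodEvent D A.toPolicy γ (γ / 8) T) (s : ℕ) (hs : s < T) :
    meanMatrix D ∈ confSet γ (pre s hs.le h) := by
  refine mem_confSet_of_deviation (meanMatrix_mem D) hγ _ (fun j i => ?_) fun j i => ?_
  · simpa using hh.1 ⟨s, hs⟩ i j true
  · simpa using hh.1 ⟨s, hs⟩ i j false

theorem abs_avgEst_sub_avgObs_le (hA : A.IsPrimal f γ x₀ T) (hm : 0 < m) (hT : T ≠ 0)
    (hγ : 1 ≤ γ) {h : Hist m d T} (hh : h ∈ goodEvent D A.toPolicy γ (γ / 8) T) (j : Fin d) :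
    |(A.avgEst x₀ h - avgObs h) j| ≤ 20 * √(γ * m / T) := by
  have hT' : (0 : ℝ) < T := by positivity
  have hγ0 : 0 ≤ γ := by linarith
  have hpt : ∀ s : Fin T, |A.point (pre s s.is_lt.le h) j -
      (meanMatrix D *ᵥ A.prob s (pre s s.is_lt.le h)) j| ≤
      ∑ i, A.prob s (pre s s.is_lt.le h) i * width γ (pre s s.is_lt.le h) i := by
    intro s
    have hp := A.prob_mem s (pre s s.is_lt.le h)
    have h1 : A.point (pre s s.is_lt.le h) j -
        (meanMatrix D *ᵥ A.prob s (pre s s.is_lt.le h)) j =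
        ∑ i, A.prob s (pre s s.is_lt.le h) i *
          (A.est s (pre s s.is_lt.le h) j i - meanMatrix D j i) := by
      simp only [EstPolicy.point, Matrix.mulVec, dotProduct]
      rw [← Finset.sum_sub_distrib]
      exact Finset.sum_congr rfl fun i _ => by ring
    rw [h1]
    refine (Finset.abs_sum_le_sum_abs _ _).trans (Finset.sum_le_sum fun i _ => ?_)
    rw [abs_mul, abs_of_nonneg (hp.1 i)]
    exact mul_le_mul_of_nonneg_left (abs_sub_le_width hγ0 (hA s s.is_lt _).1
      (meanMatrix_mem_confSet hγ hh s s.is_lt) j i) (hp.1 i)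
  have hsum : ∑ s : Fin T, A.point (pre s s.is_lt.le h) j - ∑ s, ((h s).2 j : ℝ) =
      ∑ s : Fin T, (A.point (pre s s.is_lt.le h) j -
        (meanMatrix D *ᵥ A.prob s (pre s s.is_lt.le h)) j) +
      pathSum (obsDeviation D A.toPolicy j) h := by
    simp only [pathSum, obsDeviation, Finset.sum_sub_distrib]
    ring
  have hest : |∑ s : Fin T, (A.point (pre s s.is_lt.le h) j -
      (meanMatrix D *ᵥ A.prob s (pre s s.is_lt.le h)) j)| ≤
      pathSum (widthDeviation A.toPolicy γ) h + pathSum (fun _ h x => width γ h x.1) h := by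
    refine (Finset.abs_sum_le_sum_abs _ _).trans ((Finset.sum_le_sum fun s _ => hpt s).trans ?_)
    simp [pathSum, widthDeviation]
  have hobs : |pathSum (obsDeviation D A.toPolicy j) h| ≤ 2 * √(γ / 8 * T) := by
    have h1 := hh.2.1 j true
    have h2 := hh.2.1 j false
    simp only [cond_true, cond_false] at h1 h2
    rw [abs_le]
    constructor <;> linarith
  have hroot : √(γ / 8 * T) ≤ √(γ * m * T) := by
    refine Real.sqrt_le_sqrt (mul_le_mul_of_nonneg_right ?_ hT'.le)
    have : (1 : ℝ) ≤ m := by exact_mod_cast hm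
    nlinarith
  have htotal : |∑ s : Fin T, A.point (pre s s.is_lt.le h) j - ∑ s, ((h s).2 j : ℝ)| ≤
      20 * √(γ * m * T) := by
    -- The constant 20 is 16 from the realized widths plus 2 from each of the two martingales.
    rw [hsum]
    refine (abs_add_le _ _).trans ?_
    linarith [hh.2.2, pathSum_width_le hγ0 h]
  have hdiv : (A.avgEst x₀ h - avgObs h) j =
      (∑ s : Fin T, A.point (pre s s.is_lt.le h) j - ∑ s, ((h s).2 j : ℝ)) / T := by
    rw [A.avgEst_of_pos x₀ hT]
    simp only [Pi.sub_apply, Pi.smul_apply, Finset.sum_apply, smul_eq_mul, avgObs]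
    ring
  rw [hdiv, abs_div, abs_of_pos hT', div_le_iff₀ hT']
  refine htotal.trans (le_of_eq ?_)
  have h1 : √(γ * m * T) = √(γ * m / T) * T := by
    rw [show γ * m * T = γ * m / T * T ^ 2 by field_simp, Real.sqrt_mul (by positivity),
      Real.sqrt_sq hT'.le]
  rw [h1]
  ring

theorem IsLipschitz.nonneg {q : ℝ≥0∞} (hq : 1 ≤ q) {L : ℝ} (hL : IsLipschitz q L f)
    (hd : 0 < d) : 0 ≤ L := by
  have h0 : (0 : Fin d → ℝ) ∈ cube d := mem_cube.2 fun j => by simp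
  have h1 : (1 : Fin d → ℝ) ∈ cube d := mem_cube.2 fun j => by simp
  have h2 := hL 1 h1 0 h0
  have h3 := hL 0 h0 1 h1
  have h4 : lqNorm q (0 - 1 : Fin d → ℝ) = lqNorm q (1 : Fin d → ℝ) := by
    have : Fact (1 ≤ q) := ⟨hq⟩
    rw [zero_sub, lqNorm, WithLp.toLp_neg, norm_neg, lqNorm]
  rw [sub_zero] at h2
  rw [h4] at h3
  have := one_le_lqNorm_one hd hq
  nlinarith

theorem IsLipschitz.sub_le {q : ℝ≥0∞} (hq : 1 ≤ q) {L : ℝ} (hL : IsLipschitz q L f)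
    (hd : 0 < d) {x y : Fin d → ℝ} (hx : x ∈ cube d) (hy : y ∈ cube d) {c : ℝ} (hc : 0 ≤ c)
    (hxy : ∀ j, |(x - y) j| ≤ c) : f x - f y ≤ L * lqNorm q (1 : Fin d → ℝ) * c := by
  refine (hL x hx y hy).trans ?_
  rw [mul_assoc, mul_comm _ c]
  exact mul_le_mul_of_nonneg_left (lqNorm_le_mul_lqNorm_one hq hc hxy) (hL.nonneg hq hd)

/-- Splits f(Vp) − f(average observation) at the averaged estimate: Frank-Wolfe bounds one part, the
Lipschitz condition the other. -/
theorem avgRegret_le_of_mem_goodEvent (hm : 0 < m) (hd : 0 < d) (hT : T ≠ 0) (hγ : 1 ≤ γ)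
    {q : ℝ≥0∞} (hq : 1 ≤ q) {L C : ℝ} (hrange : ∀ x ∈ cube d, f x ∈ Set.Icc (0 : ℝ) 1)
    (hf : ConcaveOn ℝ (cube d) f) (hL : IsLipschitz q L f) (hs : IsSmooth C f)
    (hx₀ : x₀ ∈ cube d) (hA : A.IsPrimal f γ x₀ T) {h : Hist m d T}
    (hh : h ∈ goodEvent D A.toPolicy γ (γ / 8) T) :
    avgRegret D f h ≤ 20 * (L * lqNorm q (1 : Fin d → ℝ) * √(γ * m / T) +
      C * Real.log T / T) := by
  have hLn : 0 ≤ L * lqNorm q (1 : Fin d → ℝ) :=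
    mul_nonneg (hL.nonneg hq hd) (lqNorm_nonneg hq 1)
  have hobs := avgObs_mem_cube h
  have hC := hs.nonneg
  have hV := fun p (hp : p ∈ stdSimplex ℝ (Fin m)) => mulVec_mem_cube (meanMatrix_mem D) hp
  rw [avgRegret, sub_le_iff_le_add]
  have hf0 := (hrange _ hobs).1
  have hT1 : (1 : ℝ) ≤ T := by exact_mod_cast Nat.one_le_iff_ne_zero.2 hT
  have hlogT := Real.log_nonneg hT1
  refine opt_le D hf hs.1.continuousOn hrange hT (by positivity) fun p hp => ?_
  -- For T = 1 the logarithmic term vanishes, but √(γm) ≥ 1, so the Lipschitz term alone covers the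
  -- whole cube.
  rcases eq_or_ne T 1 with rfl | hT2
  · have h1 := hL.sub_le hq hd (hV p hp) hobs zero_le_one fun j => by
      have h1 := mem_cube.1 (hV p hp) j
      have h2 := mem_cube.1 hobs j
      rw [Pi.sub_apply, abs_le]
      constructor <;> linarith
    have h2 : 1 ≤ √(γ * m / (1 : ℕ)) := by
      refine Real.one_le_sqrt.2 ?_
      have : (1 : ℝ) ≤ m := by exact_mod_cast hm
      rw [Nat.cast_one, div_one]
      nlinarith
    have h3 := mul_le_mul_of_nonneg_left h2 hLn
    have h4 : C * Real.log (1 : ℕ) / (1 : ℕ) = 0 := by simp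
    rw [h4]
    linarith
  · have h1 := hA.sub_le hx₀ hf hs hp (meanMatrix_mem D) hT h
      (meanMatrix_mem_confSet hγ hh)
    have h2 := hL.sub_le hq hd (hA.avgEst_mem_cube hx₀ le_rfl h) hobs (by positivity)
      (abs_avgEst_sub_avgObs_le hA hm hT hγ hh)
    have hT2' : (2 : ℝ) ≤ T := by exact_mod_cast (by omega : 2 ≤ T)
    -- A generous constant: 40 is 2 · 20, matching the denominator 2T and the final factor 20.
    have h3 : Real.logb 2 (2 * T) ≤ 40 * Real.log T := by
      have h4 := Real.log_le_log two_pos hT2'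
      have h5 := Real.log_two_gt_d9
      rw [Real.logb, Real.log_mul two_ne_zero (by positivity),
        div_le_iff₀ (Real.log_pos one_lt_two)]
      nlinarith
    have h4 : C * Real.logb 2 (2 * T) / (2 * T) ≤ 20 * (C * Real.log T / T) := by
      rw [← mul_div_assoc, div_le_div_iff₀ (by positivity) (by positivity)]
      have := mul_le_mul_of_nonneg_left h3 (mul_nonneg hC (by linarith : (0 : ℝ) ≤ T))
      nlinarith
    linarith

end

/-- With M = mTd there are at most 5M² bad events, and 40/8 = 5 gives each probability at most
(δ/M)⁵. Since δ/M ≤ 1/2, the total is at most (5/8)δ². -/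
theorem failure_probability_le {m T d : ℕ} (hmTd : 2 ≤ m * T * d) {δ γ : ℝ} (hδ0 : 0 < δ)
    (hδ1 : δ < 1) (hγ : 40 * Real.log (m * T * d / δ) ≤ γ) :
    (2 * T ^ 2 * m * d + 2 * d + 1) * Real.exp (-(γ / 8)) ≤ δ := by
  have hm : 0 < m := Nat.pos_of_ne_zero (by rintro rfl; simp at hmTd)
  have hT : 0 < T := Nat.pos_of_ne_zero (by rintro rfl; simp at hmTd)
  have hd : 0 < d := Nat.pos_of_ne_zero (by rintro rfl; simp at hmTd)
  have hM : (2 : ℝ) ≤ m * T * d := by exact_mod_cast hmTd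
  have hcount : (2 * T ^ 2 * m * d + 2 * d + 1 : ℝ) ≤ 5 * (m * T * d) ^ 2 := by
    have h1 : T ^ 2 * m * d ≤ (m * T * d) ^ 2 := by
      calc T ^ 2 * m * d ≤ T ^ 2 * m * d * (m * d) := Nat.le_mul_of_pos_right _ (by positivity)
        _ = (m * T * d) ^ 2 := by ring
    have h2 : d ≤ (m * T * d) ^ 2 := by
      calc d ≤ d * (d * (m * T) ^ 2) := Nat.le_mul_of_pos_right _ (by positivity)
        _ = (m * T * d) ^ 2 := by ring
    have h3 : 1 ≤ (m * T * d) ^ 2 := Nat.one_le_iff_ne_zero.2 (by positivity)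
    have h4 : 2 * T ^ 2 * m * d + 2 * d + 1 ≤ 5 * (m * T * d) ^ 2 := by linarith
    exact_mod_cast h4
  set M : ℝ := m * T * d with hMd
  have hexp : Real.exp (-(γ / 8)) ≤ (δ / M) ^ 5 := by
    have h1 : -(γ / 8) ≤ (5 : ℕ) * Real.log (δ / M) := by
      rw [← inv_div M δ, Real.log_inv]
      push_cast
      linarith
    refine (Real.exp_le_exp.2 h1).trans (le_of_eq ?_)
    rw [Real.exp_nat_mul, Real.exp_log (by positivity)]
  have hδM : δ / M ≤ 1 / 2 := by
    rw [div_le_div_iff₀ (by positivity) two_pos]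
    linarith
  have h0 : 0 ≤ δ / M := by positivity
  calc (2 * T ^ 2 * m * d + 2 * d + 1) * Real.exp (-(γ / 8))
      ≤ 5 * M ^ 2 * (δ / M) ^ 5 := mul_le_mul hcount hexp (Real.exp_pos _).le (by positivity)
    _ = 5 * δ ^ 2 * (δ / M) ^ 3 := by field_simp
    _ ≤ 5 * δ ^ 2 * (1 / 2) ^ 3 := by gcongr
    _ ≤ δ := by nlinarith

end BwR

end

theorem theorem4 :
    ∃ c₀ : ℝ, 0 < c₀ ∧ ∃ K : ℝ, 0 < K ∧
      ∀ (m d T : ℕ), 2 ≤ m * T * d →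
      ∀ (D : Fin m → Measure (Fin d → unitInterval)), (∀ i, IsProbabilityMeasure (D i)) →
      ∀ (q : ENNReal), 1 ≤ q →
      ∀ (f : (Fin d → ℝ) → ℝ) (L C : ℝ),
        (∀ x ∈ BwR.cube d, f x ∈ Set.Icc (0 : ℝ) 1) →
        ConcaveOn ℝ (BwR.cube d) f →
        BwR.IsLipschitz q L f →
        BwR.IsSmooth C f →
      ∀ (δ : ℝ), 0 < δ → δ < 1 →
      ∀ (γ : ℝ), c₀ * Real.log (m * T * d / δ) ≤ γ →
      ∀ (x₀ : Fin d → ℝ), x₀ ∈ BwR.cube d →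
      ∀ (A : BwR.EstPolicy m d), A.IsPrimal f γ x₀ T →
        ENNReal.ofReal (1 - δ) ≤ BwR.histLaw D A.toPolicy T
          {h | BwR.avgRegret D f h ≤
                  K * (L * BwR.lqNorm q (1 : Fin d → ℝ) * √(γ * m / T)
                    + C * Real.log T / T) ∧
               ∀ p ∈ stdSimplex ℝ (Fin m),
                  f (BwR.meanMatrix D *ᵥ p) - f (A.avgEst x₀ h) ≤
                    C * Real.logb 2 (2 * T) / (2 * T)} := by
  refine ⟨40, by norm_num, 20, by norm_num, ?_⟩
  intro m d T hmTd D hD q hq f L C hrange hf hL hs δ hδ0 hδ1 γ hγ x₀ hx₀ A hA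
  have hm : 0 < m := Nat.pos_of_ne_zero (by rintro rfl; simp at hmTd)
  have hT : T ≠ 0 := by rintro rfl; simp at hmTd
  have hd : 0 < d := Nat.pos_of_ne_zero (by rintro rfl; simp at hmTd)
  -- Here mTd ≥ 2 enters: the logarithm is at least log 2.
  have hγ1 : 1 ≤ γ := by
    have hM : (2 : ℝ) ≤ m * T * d := by exact_mod_cast hmTd
    have h1 : Real.log 2 ≤ Real.log (m * T * d / δ) := by
      refine Real.log_le_log two_pos ?_
      rw [le_div_iff₀ hδ0]
      linarith
    linarith [Real.log_two_gt_d9]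
  have hbad := (BwR.measure_compl_goodEvent_le D A.toPolicy γ (by linarith : 0 < γ / 8) T).trans
    (ENNReal.ofReal_le_ofReal (BwR.failure_probability_le hmTd hδ0 hδ1 hγ))
  have hgood : BwR.goodEvent D A.toPolicy γ (γ / 8) T ⊆
      {h | BwR.avgRegret D f h ≤
          20 * (L * BwR.lqNorm q (1 : Fin d → ℝ) * √(γ * m / T) + C * Real.log T / T) ∧
        ∀ p ∈ stdSimplex ℝ (Fin m), f (BwR.meanMatrix D *ᵥ p) - f (A.avgEst x₀ h) ≤
          C * Real.logb 2 (2 * T) / (2 * T)} := fun h hh =>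
    ⟨BwR.avgRegret_le_of_mem_goodEvent hm hd hT hγ1 hq hrange hf hL hs hx₀ hA hh,
      fun p hp => hA.sub_le hx₀ hf hs hp (BwR.meanMatrix_mem D) hT h
        (BwR.meanMatrix_mem_confSet hγ1 hh)⟩
  refine le_trans ?_ (measure_mono hgood)
  rw [ENNReal.ofReal_sub _ hδ0.le, ENNReal.ofReal_one]
  refine tsub_le_iff_right.2 ?_
  -- Subadditivity replaces the complement formula, so the event need not be measurable.
  calc (1 : ℝ≥0∞) = BwR.histLaw D A.toPolicy T
        (BwR.goodEvent D A.toPolicy γ (γ / 8) T ∪ (BwR.goodEvent D A.toPolicy γ (γ / 8) T)ᶜ) := by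
        rw [Set.union_compl_self, measure_univ]
    _ ≤ _ := (measure_union_le _ _).trans (add_le_add le_rfl hbad)
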